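/- Let $C>0$ be fixed. For $\beta\in[0,2)$ let $S_\beta=\{xe^{\pm i\theta\pi/2}: x\in[0,1],\ \theta\in[0,\beta]\}$; let $\varkappa(\beta)=1$ for $0\le\beta<1$ and $\varkappa(\beta)=\sin\frac{\beta\pi}{2}$ for $1\le\beta<2$; and let $\mathcal G=\frac{\sqrt2+2}{\sqrt2-1}$ for $0<\beta<2$, $\mathcal G=\frac{\sqrt2}{\sqrt2-1}$ for $\beta=0$. For real $\alpha,\sigma>0$, an integer $N_1\ge1$, and $\ell\in\{\lfloor\alpha\rfloor,\lceil\alpha\rceil\}$ put $$\kappa=\frac{\alpha}{\ell+1-\alpha},\quad h=\frac{\sigma\alpha}{\sqrt{N_1}},\quad T=N_1h=\sigma\alpha\sqrt{N_1},\quad N_t=\lceil(\kappa+1)N_1\rceil,$$ $$\delta=\frac{\sqrt2-1}{2},\qquad s_k=\delta+\frac12\Big(1+\cos\frac{(2\ell-2k+1)\pi}{2\ell}\Big)\quad(1\le k\le\ell).$$ For $l\in\{0,1\}$, $z\in S_\beta$ and $t\in\mathbb R$ let $$g^{(l)}(t,z)=\frac{zC^\alpha t^l e^{t}}{Ce^{t/\alpha}+z}\prod_{k=1}^{\ell}\frac{z-s_k}{Ce^{t/\alpha}+s_k},\qquad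 f^{(l)}(u,z)=g^{(l)}(u-T,z),$$ and define the truncated integral, the rectangular-rule quadrature error and the truncation error by $$I^{(l)}(z)=\int_0^{N_th}f^{(l)}(u,z)\,du,\quad E_Q^{(l)}(z)=I^{(l)}(z)-h\sum_{k=0}^{N_t}f^{(l)}(kh,z),\quad E_T^{(l)}(z)=\int_{-\infty}^{+\infty}g^{(l)}(t,z)\,dt-I^{(l)}(z).$$ Then the integral over $\mathbb R$ converges absolutely and $$E_Q^{(l)}(z)=\frac{\mathcal G^\alpha\max\{1,C^\alpha\}\,\mathcal O(1)}{\varkappa(\beta)\big[e^{(2-\beta)\alpha\pi^2/h}-1\big]}\big(1+\kappa^{l+1}\big)-E_T^{(l)}(z)+\mathcal G^\alpha\max\{1,C^\alpha\}(1+T)^l\big(1+\kappa^{l+1}\big)\frac{\mathcal O(e^{-T})}{\varkappa(\beta)},$$ where the constants in both $\mathcal O$ terms depend only on $C$. Explicitly: there is $K>0$ depending only on $C$ such that for all $\beta,\alpha,\sigma,N_1,l,\ell$ as above and all $z\in S_\beta$ the identity holds with $\mathcal O(1)$ replaced by some $c_1\in\mathbb C$ and $\mathcal O(e^{-T})$ replaced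 by $c_2e^{-T}$ with some $c_2\in\mathbb C$, where $|c_1|\le K$ and $|c_2|\le K$. In particular the constants are independent of $N_1$, $\alpha$, $\sigma$ and $z\in S_\beta$. -/

import Mathlib

namespace LightningQuadrature

noncomputable section

/-- The closed sector `S_β`: points `x e^{± iθπ/2}` with `0 ≤ x ≤ 1` and `0 ≤ θ ≤ β`. -/
def sector (β : ℝ) : Set ℂ :=
  {z | ∃ x ∈ Set.Icc (0 : ℝ) 1, ∃ θ ∈ Set.Icc (0 : ℝ) β,
    z = (x : ℂ) * Complex.exp (Complex.I * ((θ * Real.pi / 2 : ℝ) : ℂ)) ∨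
    z = (x : ℂ) * Complex.exp (-(Complex.I * ((θ * Real.pi / 2 : ℝ) : ℂ)))}

/-- `ϰ(β) = 1` for `0 ≤ β < 1` and `ϰ(β) = sin (βπ/2)` for `1 ≤ β < 2`. -/
def varkappa (β : ℝ) : ℝ := if β < 1 then 1 else Real.sin (β * Real.pi / 2)

/-- The base `𝒢`: `√2 / (√2 - 1)` for `β = 0`, and `(√2 + 2) / (√2 - 1)` for `0 < β < 2`. -/
def growthBase (β : ℝ) : ℝ :=
  if β = 0 then √2 / (√2 - 1) else (√2 + 2) / (√2 - 1)

/-- The shift `δ = (√2 - 1) / 2` of the interpolation nodes. -/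
def delta : ℝ := (√2 - 1) / 2

/-- The shifted Chebyshev points `s_k`, `1 ≤ k ≤ ell`: the roots of `T_ell (2 s - 2 δ - 1)`. -/
def node (ell k : ℕ) : ℝ :=
  delta + (1 + Real.cos ((2 * (ell : ℝ) - 2 * (k : ℝ) + 1) * Real.pi / (2 * (ell : ℝ)))) / 2

/-- `κ = α / (ell + 1 - α)`. -/
def kappa (α : ℝ) (ell : ℕ) : ℝ := α / ((ell : ℝ) + 1 - α)

/-- The step length `h = σ α / √N₁`. -/
def step (α σ : ℝ) (N₁ : ℕ) : ℝ := σ * α / √(N₁ : ℝ)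

/-- The left truncation length `T = N₁ h = σ α √N₁`. -/
def trunc (α σ : ℝ) (N₁ : ℕ) : ℝ := σ * α * √(N₁ : ℝ)

/-- `N_t = ⌈(κ + 1) N₁⌉`. -/
def numNodes (α : ℝ) (ell N₁ : ℕ) : ℕ := ⌈(kappa α ell + 1) * (N₁ : ℝ)⌉₊

/-- The integrand
`z C^α t^l e^t / (C e^{t/α} + z) * ∏_{k=1}^{ell} (z - s_k) / (C e^{t/α} + s_k)`
of the integrals over the real line. -/
def lineIntegrand (C α : ℝ) (ell l : ℕ) (z : ℂ) (t : ℝ) : ℂ :=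
  z * ((C ^ α * t ^ l * Real.exp t : ℝ) : ℂ) / (((C * Real.exp (t / α) : ℝ) : ℂ) + z) *
    ∏ k ∈ Finset.Icc 1 ell,
      (z - (node ell k : ℂ)) / (((C * Real.exp (t / α) : ℝ) : ℂ) + (node ell k : ℂ))

/-- The shifted integrand `f^{(l)}(u, z)`, i.e. the previous one at `t = u - T`. -/
def shiftedIntegrand (C α σ : ℝ) (ell N₁ l : ℕ) (z : ℂ) (u : ℝ) : ℂ :=
  lineIntegrand C α ell l z (u - trunc α σ N₁)

/-- The truncated integral `I^{(l)}(z) = ∫_0^{N_t h} f^{(l)}(u, z) du`. -/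
def truncatedIntegral (C α σ : ℝ) (ell N₁ l : ℕ) (z : ℂ) : ℂ :=
  ∫ u in (0 : ℝ)..((numNodes α ell N₁ : ℝ) * step α σ N₁),
    shiftedIntegrand C α σ ell N₁ l z u

/-- The rectangular rule `r_{N_t}^{(l)}(z) = h ∑_{k=0}^{N_t} f^{(l)}(k h, z)`. -/
def rectangularRule (C α σ : ℝ) (ell N₁ l : ℕ) (z : ℂ) : ℂ :=
  (step α σ N₁ : ℂ) * ∑ k ∈ Finset.range (numNodes α ell N₁ + 1),
    shiftedIntegrand C α σ ell N₁ l z ((k : ℝ) * step α σ N₁)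

/-- The quadrature error `E_Q^{(l)}(z)`. -/
def quadError (C α σ : ℝ) (ell N₁ l : ℕ) (z : ℂ) : ℂ :=
  truncatedIntegral C α σ ell N₁ l z - rectangularRule C α σ ell N₁ l z

/-- The truncation error `E_T^{(l)}(z)`: the integral over the whole line minus the
truncated integral. -/
def truncError (C α σ : ℝ) (ell N₁ l : ℕ) (z : ℂ) : ℂ :=
  (∫ t : ℝ, lineIntegrand C α ell l z t) - truncatedIntegral C α σ ell N₁ l z

end

end LightningQuadrature

/-! In the variable t = u - T the quadrature nodes are the points (k - N₁)h of the lattice hℤ. The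
truncated integral cancels from E_Q + E_T, which therefore equals D + R. Here D is the error of the
full trapezoidal rule on the line, ∫ g - h ∑ g(nh), and R is h times the sum of g over the lattice
points outside the window. Up to the constants, the two O-terms are bounds for D and R; c₁ and c₂
are the quotients of D and R by the prescribed majorants.

For D, Poisson summation (`norm_integral_sub_tsum_le`) reduces the claim to decay of the Fourier
integrals of g at the frequencies 2πn/h, n ≠ 0. The line of integration moves up to im t = αφ
(`norm_fourier_le_of_contour`), where the exponential contributes exp(-yαφ). The poles crossed solve
C exp(t/α) = -s with s = z or s a node, and lie at height α(π + arg s) ≥ α(2 - β)π/2. With y =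
2πn/h, both the shifted line and the residues carry the factor exp(-n(2 - β)απ²/h), and a geometric
series remains. Negative frequencies follow by conjugating z.

The difficulty is uniformity in z and α. The denominator C exp(t/α) + z may come close to zero on a
given line, so φ is chosen between two separated angles, one of which always avoids the direction of
-z (`exists_contour_angle`). For β ≥ 1 both angles are below π and the node poles, at height απ, are
not crossed. For β < 1 both exceed π, and the residues at the nodes have to be summed. They contain
∏ 1/|s_j - s_k|, which is controlled by the derivative of the Chebyshev polynomial at its roots, and
∏ |z - s_j|. The latter is bounded on [0,1] by pairing s with √2 - s, and in the right half disc by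
a crude estimate. The resulting exponential rates stay below 𝒢 with enough room to absorb polynomial
factors in α (`exists_sum_residueNorm_node_le`).

For R, the integrand on the real line is dominated by exp(t) at -∞ and by exp(-t/κ) at +∞. The
window reaches -T on the left and at least κT on the right, so both tails are of size exp(-T), up to
the factor (1 + T)^l (`norm_tail_le`). Only here does |Ce^{t/α} + z| have to be bounded below on the
real axis with an explicit constant, which is the source of ϰ. -/

namespace LightningQuadrature

/-! ### Residue theorem in a horizontal strip. -/

section

open Filter Topology MeasureTheory Complex Set

/-- The filter of points of the closed strip `0 ≤ im ≤ a` whose real part tends to `±∞`. -/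
def stripEnds (a : ℝ) : Filter ℂ :=
  comap (fun t : ℂ => |t.re|) atTop ⊓ 𝓟 {t : ℂ | 0 ≤ t.im ∧ t.im ≤ a}

theorem tendsto_intervalIntegral_vertical {a : ℝ} (ha : 0 ≤ a) {F : ℂ → ℂ}
    (hF : Tendsto F (stripEnds a) (𝓝 0)) {u : ℕ → ℝ}
    (hu : Tendsto (fun n => |u n|) atTop atTop) :
    Tendsto (fun n => ∫ y in (0 : ℝ)..a, F (u n + y * I)) atTop (𝓝 0) := by
  rw [Metric.tendsto_atTop]
  intro ε hε
  have h1 : ∀ᶠ t in stripEnds a, ‖F t‖ < ε / (a + 1) := by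
    have := (Metric.tendsto_nhds.1 hF) (ε / (a + 1)) (by positivity)
    simpa using this
  rw [stripEnds, eventually_inf_principal, eventually_comap] at h1
  obtain ⟨N, hN⟩ := (hu.eventually h1).exists_forall_of_atTop
  refine ⟨N, fun n hn => ?_⟩
  rw [dist_zero_right]
  have hb : ‖∫ y in (0 : ℝ)..a, F (u n + y * I)‖ ≤ ε / (a + 1) * |a - 0| := by
    apply intervalIntegral.norm_integral_le_of_norm_le_const
    intro y hy
    rw [uIoc_of_le ha] at hy
    refine (hN n hn _ (by simp) ?_).le
    simpa using ⟨hy.1.le, hy.2⟩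
  refine hb.trans_lt ?_
  rw [sub_zero, abs_of_nonneg ha, div_mul_eq_mul_div, div_lt_iff₀ (by positivity)]
  nlinarith

/-- Cauchy's theorem on the rectangles [-n, n] × [0, a]; the vertical sides vanish in the limit
because F tends to 0 at the ends of the strip. -/
theorem integral_line_eq_of_differentiable {a : ℝ} (ha : 0 ≤ a) {F : ℂ → ℂ}
    (hd : ∀ t : ℂ, 0 ≤ t.im → t.im ≤ a → DifferentiableAt ℂ F t)
    (hF : Tendsto F (stripEnds a) (𝓝 0))
    (h0 : Integrable fun x : ℝ => F x) (h1 : Integrable fun x : ℝ => F (x + a * I)) :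
    ∫ x : ℝ, F x = ∫ x : ℝ, F (x + a * I) := by
  have key : ∀ n : ℕ, (∫ x in (-(n : ℝ))..n, F x) - (∫ x in (-(n : ℝ))..n, F (x + a * I)) =
      I * (∫ y in (0 : ℝ)..a, F (((-(n : ℝ) : ℝ) : ℂ) + y * I)) -
      I * (∫ y in (0 : ℝ)..a, F (((n : ℝ) : ℂ) + y * I)) := by
    intro n
    have := integral_boundary_rect_eq_zero_of_differentiableOn F (-(n : ℂ)) (n + a * I) (by
      intro t ht
      rw [mem_reProdIm] at ht
      have h2 := ht.2
      simp [uIcc_of_le ha] at h2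
      exact (hd t h2.1 h2.2).differentiableWithinAt)
    simp at this
    push_cast
    linear_combination this
  have hn : Tendsto (fun n : ℕ => (n : ℝ)) atTop atTop := tendsto_natCast_atTop_atTop
  have hn' : Tendsto (fun n : ℕ => -(n : ℝ)) atTop atBot := tendsto_neg_atTop_atBot.comp hn
  have l0 := intervalIntegral_tendsto_integral h0 hn' hn
  have l1 := intervalIntegral_tendsto_integral h1 hn' hn
  have r0 := (tendsto_intervalIntegral_vertical ha hF (u := fun n : ℕ => -(n : ℝ))
    (by simpa using hn)).const_mul I
  have r1 := (tendsto_intervalIntegral_vertical ha hF (u := fun n : ℕ => (n : ℝ))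
    (by simpa using hn)).const_mul I
  have hl := l0.sub l1
  have hr := r0.sub r1
  simp only [key] at hl
  have := tendsto_nhds_unique hl hr
  simpa [sub_eq_zero] using this

theorem inv_add_mul_I (x y : ℝ) (hy : y ≠ 0) : ((x : ℂ) + y * I)⁻¹ =
    ((x / (x ^ 2 + y ^ 2) : ℝ) : ℂ) - ((y / (x ^ 2 + y ^ 2) : ℝ) : ℂ) * I := by
  have h : x ^ 2 + y ^ 2 ≠ 0 := by positivity
  apply Complex.ext <;>
    simp [-ofReal_div, Complex.inv_re, Complex.inv_im, normSq_apply, ← sq, neg_div]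

theorem integrable_div_sq_add_sq (y : ℝ) (hy : y ≠ 0) :
    Integrable fun x : ℝ => y / (x ^ 2 + y ^ 2) := by
  have := (integrable_inv_one_add_sq.comp_div hy).const_mul y⁻¹
  refine this.congr (ae_of_all _ fun x => ?_)
  have h : x ^ 2 + y ^ 2 ≠ 0 := by positivity
  have h' : 1 + (x / y) ^ 2 ≠ 0 := by positivity
  simp only
  field_simp
  ring

theorem integral_div_sq_add_sq (y : ℝ) (hy : y ≠ 0) :
    ∫ x : ℝ, y / (x ^ 2 + y ^ 2) = SignType.sign y * Real.pi := by
  have h1 : ∀ x : ℝ, y / (x ^ 2 + y ^ 2) = y⁻¹ * (1 + (x / y) ^ 2)⁻¹ := by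
    intro x
    have h : x ^ 2 + y ^ 2 ≠ 0 := by positivity
    have h' : 1 + (x / y) ^ 2 ≠ 0 := by positivity
    field_simp
    ring
  simp only [h1]
  rw [integral_const_mul, Measure.integral_comp_div (fun x : ℝ => (1 + x ^ 2)⁻¹) y,
    integral_univ_inv_one_add_sq, smul_eq_mul]
  rcases hy.lt_or_gt with h | h
  · rw [abs_of_neg h, sign_neg h]
    simp
    field_simp
  · rw [abs_of_pos h, sign_pos h]
    simp
    field_simp

theorem integrable_inv_sub_inv {y y' : ℝ} (hy : y ≠ 0) (hy' : y' ≠ 0) (x₀ : ℝ) :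
    Integrable fun x : ℝ => ((x - x₀ : ℂ) + y * I)⁻¹ - ((x - x₀ : ℂ) + y' * I)⁻¹ := by
  have : Integrable fun x : ℝ => ((x : ℂ) + y * I)⁻¹ - ((x : ℂ) + y' * I)⁻¹ := by
    have e : (fun x : ℝ => ((x : ℂ) + y * I)⁻¹ - ((x : ℂ) + y' * I)⁻¹) =
        fun x : ℝ => (((y' ^ 2 - y ^ 2) * (x / ((x ^ 2 + y ^ 2) * (x ^ 2 + y' ^ 2))) : ℝ) : ℂ)
          - ((y / (x ^ 2 + y ^ 2) : ℝ) : ℂ) * I + ((y' / (x ^ 2 + y' ^ 2) : ℝ) : ℂ) * I := by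
      funext x
      rw [inv_add_mul_I x y hy, inv_add_mul_I x y' hy']
      have : (y' ^ 2 - y ^ 2) * (x / ((x ^ 2 + y ^ 2) * (x ^ 2 + y' ^ 2))) =
        x / (x ^ 2 + y ^ 2) - x / (x ^ 2 + y' ^ 2) := by
        have h : x ^ 2 + y ^ 2 ≠ 0 := by positivity
        have h' : x ^ 2 + y' ^ 2 ≠ 0 := by positivity
        field_simp
        ring
      rw [this]
      push_cast
      ring
    rw [e]
    refine ((Integrable.ofReal (Integrable.const_mul ?_ _)).sub
      ((integrable_div_sq_add_sq y hy).ofReal.mul_const I)).add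
      ((integrable_div_sq_add_sq y' hy').ofReal.mul_const I)
    refine Integrable.mono' (((integrable_div_sq_add_sq y hy).const_mul (y⁻¹ * (|y'|⁻¹)))) ?_ ?_
    · refine Continuous.aestronglyMeasurable ?_
      refine Continuous.div (by fun_prop) (by fun_prop) fun x => by positivity
    · refine ae_of_all _ fun x => ?_
      have h : 0 < x ^ 2 + y ^ 2 := by positivity
      have h' : 0 < x ^ 2 + y' ^ 2 := by positivity
      have hp : 0 < |y'| := abs_pos.2 hy'
      have : |x| * |y'| ≤ x ^ 2 + y' ^ 2 := by
        nlinarith [sq_abs x, sq_abs y', sq_nonneg (|x| - |y'|), abs_nonneg x]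
      rw [Real.norm_eq_abs, abs_div, abs_of_pos (mul_pos h h')]
      rw [div_le_iff₀ (mul_pos h h')]
      have e : y⁻¹ * |y'|⁻¹ * (y / (x ^ 2 + y ^ 2)) * ((x ^ 2 + y ^ 2) * (x ^ 2 + y' ^ 2)) =
        (x ^ 2 + y' ^ 2) / |y'| := by field_simp
      rw [e, le_div_iff₀ hp]
      exact this
  have h2 := this.comp_sub_right x₀
  simpa using h2

/-- Symmetrizing x ↦ -x removes the odd real part and leaves two Poisson kernels, each of total mass
±π according to the sign of its height. -/
theorem integral_inv_sub_inv {y y' : ℝ} (hy : y ≠ 0) (hy' : y' ≠ 0) (x₀ : ℝ) :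
    ∫ x : ℝ, (((x - x₀ : ℂ) + y * I)⁻¹ - ((x - x₀ : ℂ) + y' * I)⁻¹) =
      (SignType.sign y' - SignType.sign y : ℝ) * Real.pi * I := by
  set k : ℝ → ℂ := fun x => ((x : ℂ) + y * I)⁻¹ - ((x : ℂ) + y' * I)⁻¹ with hk
  have hint : Integrable k := by simpa using integrable_inv_sub_inv hy hy' 0
  have h1 : ∫ x : ℝ, (((x - x₀ : ℂ) + y * I)⁻¹ - ((x - x₀ : ℂ) + y' * I)⁻¹) = ∫ x, k x := by
    rw [← integral_sub_right_eq_self k x₀]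
    simp [hk]
  have h2 : ∫ x, k x = ∫ x, k (-x) := (integral_neg_eq_self k volume).symm
  have h3 : (∫ x, k x) + ∫ x, k (-x) = ∫ x, (k x + k (-x)) :=
    (integral_add hint hint.comp_neg).symm
  have h4 : ∀ x, k x + k (-x) =
      (((2 * (y' / (x ^ 2 + y' ^ 2)) - 2 * (y / (x ^ 2 + y ^ 2)) : ℝ)) : ℂ) * I := by
    intro x
    simp only [hk]
    rw [inv_add_mul_I x y hy, inv_add_mul_I x y' hy', inv_add_mul_I (-x) y hy,
      inv_add_mul_I (-x) y' hy']
    simp only [neg_sq]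
    push_cast
    ring
  simp only [h4] at h3
  rw [integral_mul_const, integral_complex_ofReal, integral_sub ((integrable_div_sq_add_sq y' hy').const_mul 2)
    ((integrable_div_sq_add_sq y hy).const_mul 2), integral_const_mul, integral_const_mul,
    integral_div_sq_add_sq y hy, integral_div_sq_add_sq y' hy'] at h3
  rw [h1]
  rw [← h2] at h3
  push_cast at h3 ⊢
  linear_combination h3 / 2

/-- `1 / (t - p) - 1 / (t - conj p)`: a simple pole at `p` whose integrals over horizontal lines
are explicit. -/
noncomputable def polePart (p t : ℂ) : ℂ := (t - p)⁻¹ - (t - (starRingEnd ℂ) p)⁻¹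

theorem polePart_ofReal_add (p : ℂ) (x y : ℝ) : polePart p (x + y * I) =
    ((x - (p.re : ℝ) : ℂ) + ((y - p.im : ℝ) : ℂ) * I)⁻¹ -
      ((x - (p.re : ℝ) : ℂ) + ((y + p.im : ℝ) : ℂ) * I)⁻¹ := by
  rw [polePart]
  congr 2 <;> apply Complex.ext <;> simp

theorem integrable_polePart {p : ℂ} {y : ℝ} (h1 : y - p.im ≠ 0) (h2 : y + p.im ≠ 0) :
    Integrable fun x : ℝ => polePart p (x + y * I) := by
  simp only [polePart_ofReal_add]
  exact integrable_inv_sub_inv h1 h2 _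

theorem integral_polePart {p : ℂ} {y : ℝ} (h1 : y - p.im ≠ 0) (h2 : y + p.im ≠ 0) :
    ∫ x : ℝ, polePart p (x + y * I) =
      (SignType.sign (y + p.im) - SignType.sign (y - p.im) : ℝ) * Real.pi * I := by
  simp only [polePart_ofReal_add]
  exact integral_inv_sub_inv h1 h2 _

theorem tendsto_polePart_stripEnds (p : ℂ) (a : ℝ) :
    Tendsto (polePart p) (stripEnds a) (𝓝 0) := by
  have h0 : Tendsto (fun t : ℂ => |t.re|) (stripEnds a) atTop := tendsto_inf_left tendsto_comap
  have hn : Tendsto (fun t : ℂ => t) (stripEnds a) (Bornology.cobounded ℂ) :=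
    tendsto_norm_atTop_iff_cobounded.1 (tendsto_atTop_mono (fun t => abs_re_le_norm t) h0)
  have h : ∀ q : ℂ, Tendsto (fun t : ℂ => (t - q)⁻¹) (stripEnds a) (𝓝 0) := fun q =>
    (tendsto_inv₀_cobounded.comp ((tendsto_sub_const_cobounded q).comp hn))
  have := (h p).sub (h ((starRingEnd ℂ) p))
  rw [sub_zero] at this
  exact this

theorem differentiableAt_polePart {p t : ℂ} (h1 : t ≠ p) (h2 : t ≠ (starRingEnd ℂ) p) :
    DifferentiableAt ℂ (polePart p) t := by
  unfold polePart
  refine DifferentiableAt.sub ?_ ?_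
  · exact DifferentiableAt.inv (by fun_prop) (sub_ne_zero.2 h1)
  · exact DifferentiableAt.inv (by fun_prop) (sub_ne_zero.2 h2)

/-- Residue theorem for a strip: shifting the line of integration across finitely many simple
poles. -/
theorem integral_line_sub_integral_line {a : ℝ} (ha : 0 ≤ a) (P : Finset ℂ) (r : ℂ → ℂ) :
    ∀ {F : ℂ → ℂ}, (∀ p ∈ P, 0 < p.im ∧ p.im < a) →
    (∀ t : ℂ, 0 ≤ t.im → t.im ≤ a → t ∉ P → DifferentiableAt ℂ F t) →
    (∀ p ∈ P, Tendsto (fun t => (t - p) * F t) (𝓝[≠] p) (𝓝 (r p))) →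
    Tendsto F (stripEnds a) (𝓝 0) →
    Integrable (fun x : ℝ => F x) → Integrable (fun x : ℝ => F (x + a * I)) →
    (∫ x : ℝ, F x) - ∫ x : ℝ, F (x + a * I) = 2 * Real.pi * I * ∑ p ∈ P, r p := by
  classical
  induction P using Finset.induction_on with
  | empty =>
    intro F _ hd _ hF h0 h1
    rw [integral_line_eq_of_differentiable ha (fun t h h' => hd t h h' (by simp)) hF h0 h1]
    simp
  | insert p P hp ih =>
    intro F hP hd hr hF h0 h1
    have hpi := hP p (Finset.mem_insert_self _ _)
    have hconj : p ≠ (starRingEnd ℂ) p := fun h => by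
      have := congrArg Complex.im h
      simp at this
      linarith [hpi.1]
    -- Subtracting `polePart` rather than 1/(t - p) keeps the integrals over lines absolutely
    -- convergent, and the extra pole at conj p lies below the strip. The singularity of G at p is
    -- removable; H fills it in, so the induction hypothesis applies to H with one pole fewer.
    set G : ℂ → ℂ := fun t => F t - r p * polePart p t with hG
    set H : ℂ → ℂ := Function.update G p (limUnder (𝓝[≠] p) G) with hH
    have hHG : ∀ t, t ≠ p → H t = G t := fun t ht => Function.update_of_ne ht _ _
    have hHGe : ∀ t, t ≠ p → H =ᶠ[𝓝 t] G := fun t ht => by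
      filter_upwards [isOpen_ne.mem_nhds ht] with s hs using hHG s hs
    have hconj' : ∀ t : ℂ, 0 ≤ t.im → t ≠ (starRingEnd ℂ) p := fun t ht h => by
      have := congrArg Complex.im h
      simp at this
      linarith [hpi.1]
    have hGd : ∀ t : ℂ, 0 ≤ t.im → t.im ≤ a → t ∉ insert p P → DifferentiableAt ℂ G t := by
      intro t ht ht' htP
      refine (hd t ht ht' htP).sub ((differentiableAt_polePart ?_ (hconj' t ht)).const_mul _)
      rintro rfl
      exact htP (Finset.mem_insert_self _ _)
    have hGlim : Tendsto (fun t => (t - p) * G t) (𝓝[≠] p) (𝓝 0) := by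
      have e1 := hr p (Finset.mem_insert_self _ _)
      have e2 : Tendsto (fun t : ℂ => r p * (1 - (t - p) * (t - (starRingEnd ℂ) p)⁻¹)) (𝓝[≠] p)
          (𝓝 (r p * (1 - (p - p) * (p - (starRingEnd ℂ) p)⁻¹))) := by
        refine Tendsto.mono_left ?_ nhdsWithin_le_nhds
        refine ContinuousAt.tendsto (f := fun t : ℂ =>
          r p * (1 - (t - p) * (t - (starRingEnd ℂ) p)⁻¹)) ?_
        have : p - (starRingEnd ℂ) p ≠ 0 := sub_ne_zero.2 hconj
        fun_prop (disch := assumption)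
      have e3 := e1.sub e2
      simp only [sub_self, zero_mul, sub_zero, mul_one] at e3
      refine e3.congr' ?_
      filter_upwards [self_mem_nhdsWithin] with t ht
      have : t - p ≠ 0 := sub_ne_zero.2 ht
      simp only [hG, polePart]
      field_simp
    have hnhds : ∀ᶠ t in 𝓝 p, t ≠ p → DifferentiableAt ℂ G t := by
      have o1 : ∀ᶠ t : ℂ in 𝓝 p, 0 < t.im :=
        continuous_im.continuousAt.eventually (lt_mem_nhds hpi.1)
      have o2 : ∀ᶠ t : ℂ in 𝓝 p, t.im < a :=
        continuous_im.continuousAt.eventually (gt_mem_nhds hpi.2)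
      have o3 : ∀ᶠ t : ℂ in 𝓝 p, t ∉ (P : Set ℂ) :=
        P.finite_toSet.isClosed.isOpen_compl.mem_nhds (by simpa using hp)
      filter_upwards [o1, o2, o3] with t h1 h2 h3 hne
      exact hGd t h1.le h2.le (by simpa [hne] using h3)
    have hHp : DifferentiableAt ℂ H p := by
      have hs : {t | t ≠ p → DifferentiableAt ℂ G t} ∈ 𝓝 p := hnhds
      refine (differentiableOn_update_limUnder_of_isLittleO hs ?_ ?_).differentiableAt hs
      · intro t ht
        exact (ht.1 ht.2).differentiableWithinAt
      · rw [Asymptotics.isLittleO_iff_tendsto']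
        · have e4 : Tendsto (fun t => (t - p) * G p) (𝓝[≠] p) (𝓝 ((p - p) * G p)) := by
            refine Tendsto.mono_left ?_ nhdsWithin_le_nhds
            exact Continuous.tendsto (f := fun t : ℂ => (t - p) * G p) (by fun_prop) p
          have e5 := hGlim.sub e4
          simp only [sub_self, zero_mul] at e5
          refine e5.congr fun t => ?_
          rw [div_inv_eq_mul]
          ring
        · filter_upwards [self_mem_nhdsWithin] with t ht h
          exact absurd (inv_eq_zero.1 h) (sub_ne_zero.2 ht)
    have hline : ∀ y : ℝ, y ≠ p.im → (fun x : ℝ => H (x + y * I)) =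
        fun x : ℝ => F (x + y * I) - r p * polePart p (x + y * I) := by
      intro y hy
      funext x
      rw [hHG]
      intro h
      apply hy
      rw [← h]
      simp
    have hl0 := hline 0 hpi.1.ne
    have hla := hline a hpi.2.ne'
    simp only [ofReal_zero, zero_mul, add_zero] at hl0
    have i0 := integrable_polePart (p := p) (y := 0) (by linarith [hpi.1] : _ < _).ne
      (by linarith [hpi.1] : _ < _).ne'
    have i1 := integrable_polePart (p := p) (y := a) (by linarith [hpi.2] : _ < _).ne'
      (by linarith [hpi.1] : _ < _).ne'
    have v0 := integral_polePart (p := p) (y := 0) (by linarith [hpi.1] : _ < _).ne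
      (by linarith [hpi.1] : _ < _).ne'
    have v1 := integral_polePart (p := p) (y := a) (by linarith [hpi.2] : _ < _).ne'
      (by linarith [hpi.1] : _ < _).ne'
    -- The bottom line separates p from conj p and gives 2πi; the top line lies above both and gives
    -- 0.
    rw [sign_pos (by linarith [hpi.1]), sign_neg (by linarith [hpi.1])] at v0
    rw [sign_pos (by linarith [hpi.1]), sign_pos (by linarith [hpi.2])] at v1
    simp only [ofReal_zero, zero_mul, add_zero] at i0 v0
    have main := ih (F := H) (fun q hq => hP q (Finset.mem_insert_of_mem hq)) ?_ ?_ ?_ ?_ ?_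
    · rw [hl0, hla, integral_sub h0 (i0.const_mul _), integral_sub h1 (i1.const_mul _),
        integral_const_mul, integral_const_mul, v0, v1] at main
      rw [Finset.sum_insert hp]
      simp only [SignType.coe_one, SignType.coe_neg] at main
      push_cast at main
      linear_combination main
    · intro t ht ht' htP
      by_cases htp : t = p
      · rwa [htp]
      · exact (hGd t ht ht' (by simp [htp, htP])).congr_of_eventuallyEq (hHGe t htp)
    · intro q hq
      have hqp : q ≠ p := fun h => hp (h ▸ hq)
      have e1 := hr q (Finset.mem_insert_of_mem hq)
      have e2 : Tendsto (fun t : ℂ => (t - q) * (r p * polePart p t)) (𝓝[≠] q)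
          (𝓝 ((q - q) * (r p * polePart p q))) := by
        refine Tendsto.mono_left ?_ nhdsWithin_le_nhds
        have := (differentiableAt_polePart hqp
          (hconj' q (hP q (Finset.mem_insert_of_mem hq)).1.le)).continuousAt
        refine ContinuousAt.tendsto (f := fun t : ℂ => (t - q) * (r p * polePart p t)) ?_
        fun_prop
      have e3 := e1.sub e2
      simp only [sub_self, zero_mul, sub_zero] at e3
      refine e3.congr' ?_
      filter_upwards [(hHGe q hqp).filter_mono nhdsWithin_le_nhds] with t ht
      rw [ht]
      simp only [hG]
      ring
    · have e := hF.sub ((tendsto_polePart_stripEnds p a).const_mul (r p))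
      simp only [mul_zero, sub_zero] at e
      refine e.congr' ?_
      have h0 : Tendsto (fun t : ℂ => |t.re|) (stripEnds a) atTop := tendsto_inf_left tendsto_comap
      filter_upwards [h0.eventually (eventually_gt_atTop |p.re|)] with t ht
      rw [hHG t (fun h => by simp [h] at ht)]
    · rw [hl0]
      exact h0.sub (i0.const_mul _)
    · rw [hla]
      exact h1.sub (i1.const_mul _)

end

/-! ### Poisson summation and the trapezoidal rule on the line. -/

section

open Filter Topology MeasureTheory Complex Set

theorem isBigO_comp_mul_of_le_inv_one_add_sq {g : ℝ → ℂ} {M h : ℝ} (hh : 0 < h)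
    (hg : ∀ t, ‖g t‖ ≤ M * (1 + t ^ 2)⁻¹) :
    (fun x => g (h * x)) =O[cocompact ℝ] fun x : ℝ => |x| ^ (-2 : ℝ) := by
  have hM : 0 ≤ M := by simpa using (norm_nonneg _).trans (hg 0)
  refine Asymptotics.IsBigO.of_bound (M / h ^ 2) ?_
  have : ∀ᶠ x : ℝ in cocompact ℝ, x ≠ 0 := by
    simpa using (isCompact_singleton (x := (0 : ℝ))).compl_mem_cocompact
  filter_upwards [this] with x hx
  have hx2 : 0 < x ^ 2 := by positivity
  refine (hg _).trans ?_
  have e : |x| ^ (-2 : ℝ) = (x ^ 2)⁻¹ := by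
    rw [Real.rpow_neg (abs_nonneg x), ← sq_abs]
    norm_num
  rw [e, Real.norm_of_nonneg (by positivity), div_mul_eq_mul_div, mul_div_assoc]
  refine mul_le_mul_of_nonneg_left ?_ hM
  rw [inv_eq_one_div, inv_eq_one_div, div_div]
  exact one_div_le_one_div_of_le (by positivity) (by nlinarith)

theorem summable_comp_mul_of_le_inv_one_add_sq {g : ℝ → ℂ} {M h : ℝ} (hh : 0 < h)
    (hg : ∀ t, ‖g t‖ ≤ M * (1 + t ^ 2)⁻¹) : Summable fun n : ℤ => g (n * h) := by
  have := (isBigO_comp_mul_of_le_inv_one_add_sq hh hg).comp_tendsto Int.tendsto_coe_cofinite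
  refine summable_of_isBigO (Real.summable_abs_int_rpow (by norm_num : (1 : ℝ) < 2)) ?_
  refine this.congr_left fun n => ?_
  simp [mul_comm]

/-- The trapezoidal rule on the real line, for an integrand whose Fourier transform decays
geometrically along the dual lattice. -/
theorem norm_integral_sub_tsum_le {g : ℝ → ℂ} (hc : Continuous g) {M h B q : ℝ} (hh : 0 < h)
    (hg : ∀ t, ‖g t‖ ≤ M * (1 + t ^ 2)⁻¹) (hq : 0 ≤ q) (hq1 : q < 1)
    (hF : ∀ n : ℕ, ‖∫ t : ℝ, g t * cexp (I * ((2 * Real.pi * (n + 1) / h : ℝ) * t))‖ ≤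
      B * q ^ (n + 1))
    (hF' : ∀ n : ℕ, ‖∫ t : ℝ, g t * cexp (-(I * ((2 * Real.pi * (n + 1) / h : ℝ) * t)))‖ ≤
      B * q ^ (n + 1)) :
    ‖(∫ t, g t) - h * ∑' n : ℤ, g (n * h)‖ ≤ 2 * B * (q / (1 - q)) := by
  set f : ℝ → ℂ := fun x => g (h * x) with hf
  have hfour : ∀ w : ℝ, FourierTransform.fourier f w =
      (h⁻¹ : ℂ) * ∫ t : ℝ, g t * cexp (I * ((-(2 * Real.pi * w / h) : ℝ) * t)) := by
    intro w
    rw [Real.fourier_real_eq_integral_exp_smul]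
    have := Measure.integral_comp_mul_left
      (fun t : ℝ => g t * cexp (I * ((-(2 * Real.pi * w / h) : ℝ) * t))) h
    rw [abs_of_pos (inv_pos.2 hh), real_smul, ofReal_inv] at this
    rw [← this]
    congr 1
    funext v
    rw [smul_eq_mul, mul_comm, hf]
    congr 2
    push_cast
    have : (h : ℂ) ≠ 0 := by exact_mod_cast hh.ne'
    field_simp
  have hinv : ‖(h⁻¹ : ℂ)‖ = h⁻¹ := by
    rw [norm_inv, norm_real, Real.norm_of_nonneg hh.le]
  have hb1 : ∀ n : ℕ, ‖FourierTransform.fourier f (((n + 1 : ℕ) : ℤ) : ℝ)‖ ≤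
      h⁻¹ * (B * q ^ (n + 1)) := by
    intro n
    rw [hfour, norm_mul, hinv]
    refine mul_le_mul_of_nonneg_left (le_trans (le_of_eq ?_) (hF' n)) (by positivity)
    congr 2
    funext t
    congr 2
    push_cast
    ring
  have hb2 : ∀ n : ℕ, ‖FourierTransform.fourier f ((-((n : ℤ) + 1) : ℤ) : ℝ)‖ ≤
      h⁻¹ * (B * q ^ (n + 1)) := by
    intro n
    rw [hfour, norm_mul, hinv]
    refine mul_le_mul_of_nonneg_left (le_trans (le_of_eq ?_) (hF n)) (by positivity)
    congr 2
    funext t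
    congr 2
    push_cast
    ring
  have hgeo : HasSum (fun n : ℕ => h⁻¹ * (B * q ^ (n + 1))) (h⁻¹ * (B * (q / (1 - q)))) := by
    have := (((hasSum_geometric_of_lt_one hq hq1).mul_left q).mul_left B).mul_left h⁻¹
    simpa only [← pow_succ', ← div_eq_mul_inv] using this
  have hs1 : Summable fun n : ℕ => FourierTransform.fourier f (((n + 1 : ℕ) : ℤ) : ℝ) :=
    Summable.of_norm_bounded hgeo.summable hb1
  have hs2 : Summable fun n : ℕ => FourierTransform.fourier f ((-((n : ℤ) + 1) : ℤ) : ℝ) :=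
    Summable.of_norm_bounded hgeo.summable hb2
  have hs1' : Summable fun n : ℕ => FourierTransform.fourier f (((n : ℤ) + 1 : ℤ) : ℝ) := by
    simpa using hs1
  have hsum : Summable fun n : ℤ => FourierTransform.fourier f (n : ℝ) :=
    Summable.of_add_one_of_neg_add_one hs1' hs2
  have hP := Real.tsum_eq_tsum_fourier_of_rpow_decay_of_summable
    (f := f) (by fun_prop) (by norm_num : (1 : ℝ) < 2) (isBigO_comp_mul_of_le_inv_one_add_sq hh hg)
    hsum 0
  have hP' : ∑' n : ℤ, g (n * h) = ∑' n : ℤ, FourierTransform.fourier f (n : ℝ) := by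
    simpa [hf, mul_comm] using hP
  have hsplit : ∑' n : ℤ, FourierTransform.fourier f (n : ℝ) =
      (∑' n : ℕ, FourierTransform.fourier f (((n + 1 : ℕ) : ℤ) : ℝ)) +
        FourierTransform.fourier f 0 +
      ∑' n : ℕ, FourierTransform.fourier f ((-((n : ℤ) + 1) : ℤ) : ℝ) := by
    rw [tsum_of_add_one_of_neg_add_one (f := fun n : ℤ => FourierTransform.fourier f (n : ℝ))
      hs1' hs2]
    simp
  have hzero : FourierTransform.fourier f 0 = (h⁻¹ : ℂ) * ∫ t, g t := by
    rw [hfour]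
    simp
  have n1 : ‖∑' n : ℕ, FourierTransform.fourier f (((n + 1 : ℕ) : ℤ) : ℝ)‖ ≤
      h⁻¹ * (B * (q / (1 - q))) := tsum_of_norm_bounded hgeo hb1
  have n2 : ‖∑' n : ℕ, FourierTransform.fourier f ((-((n : ℤ) + 1) : ℤ) : ℝ)‖ ≤
      h⁻¹ * (B * (q / (1 - q))) := tsum_of_norm_bounded hgeo hb2
  rw [hP', hsplit, hzero]
  set S1 := ∑' n : ℕ, FourierTransform.fourier f (((n + 1 : ℕ) : ℤ) : ℝ)
  set S2 := ∑' n : ℕ, FourierTransform.fourier f ((-((n : ℤ) + 1) : ℤ) : ℝ)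
  have hne : (h : ℂ) ≠ 0 := by exact_mod_cast hh.ne'
  -- The zero frequency is exactly the integral, so only the two geometric tails survive.
  have e : (∫ t, g t) - h * (S1 + (h⁻¹ : ℂ) * (∫ t, g t) + S2) = -(h * (S1 + S2)) := by
    field_simp
    ring
  rw [e, norm_neg, norm_mul, norm_real, Real.norm_of_nonneg hh.le]
  calc h * ‖S1 + S2‖ ≤ h * (h⁻¹ * (B * (q / (1 - q))) + h⁻¹ * (B * (q / (1 - q)))) :=
        mul_le_mul_of_nonneg_left ((norm_add_le _ _).trans (add_le_add n1 n2)) hh.le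
    _ = _ := by field_simp; ring

end

/-! ### Chebyshev estimates for the interpolation nodes. -/

section

open Polynomial

/-- The Chebyshev points `cos ((2 ell - 2 k + 1) π / (2 ell))`. -/
noncomputable def chebPoint (ell k : ℕ) : ℝ :=
  Real.cos ((2 * (ell : ℝ) - 2 * (k : ℝ) + 1) * Real.pi / (2 * (ell : ℝ)))

theorem node_eq (ell k : ℕ) : node ell k = (√2 + chebPoint ell k) / 2 := by
  unfold node delta chebPoint
  ring

theorem delta_pos : 0 < delta := by
  have : (1 : ℝ) < √2 := by
    rw [Real.lt_sqrt] <;> norm_num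
  unfold delta
  linarith

theorem delta_le_node (ell k : ℕ) : delta ≤ node ell k := by
  rw [node_eq, delta]
  have := Real.neg_one_le_cos ((2 * (ell : ℝ) - 2 * (k : ℝ) + 1) * Real.pi / (2 * (ell : ℝ)))
  unfold chebPoint
  linarith

theorem node_pos (ell k : ℕ) : 0 < node ell k := delta_pos.trans_le (delta_le_node ell k)

theorem node_le (ell k : ℕ) : node ell k ≤ (√2 + 1) / 2 := by
  rw [node_eq]
  have := Real.cos_le_one ((2 * (ell : ℝ) - 2 * (k : ℝ) + 1) * Real.pi / (2 * (ell : ℝ)))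
  unfold chebPoint
  linarith

theorem chebPoint_eq_range {ell k : ℕ} (hk : k ∈ Finset.Icc 1 ell) :
    chebPoint ell k = Real.cos ((2 * ((ell - k : ℕ) : ℝ) + 1) * Real.pi / (2 * ell)) := by
  rw [Finset.mem_Icc] at hk
  rw [chebPoint, Nat.cast_sub hk.2]
  ring_nf

theorem chebPoint_injOn (ell : ℕ) : Set.InjOn (chebPoint ell) (Finset.Icc 1 ell) := by
  intro i hi j hj h
  have hi' := Finset.mem_coe.1 hi
  have hj' := Finset.mem_coe.1 hj
  rw [chebPoint_eq_range hi', chebPoint_eq_range hj'] at h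
  have hn := (Finset.range ell).nodup_map_iff_injOn.mp (Polynomial.Chebyshev.roots_T_real_nodup ell)
  rw [Finset.mem_Icc] at hi' hj'
  have := hn (by simp; omega) (by simp; omega) h
  omega

theorem node_injOn (ell : ℕ) : Set.InjOn (node ell) (Finset.Icc 1 ell) := by
  intro i hi j hj h
  rw [node_eq, node_eq] at h
  exact chebPoint_injOn ell hi hj (by linarith)

theorem chebPoint_reflect {ell k : ℕ} (hk : k ∈ Finset.Icc 1 ell) :
    chebPoint ell (ell + 1 - k) = -chebPoint ell k := by
  rw [Finset.mem_Icc] at hk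
  have hl : (ell : ℝ) ≠ 0 := by
    have : 0 < ell := by omega
    positivity
  rw [chebPoint, chebPoint, ← Real.cos_pi_sub, Nat.cast_sub (by omega)]
  congr 1
  push_cast
  field_simp
  ring

theorem node_reflect {ell k : ℕ} (hk : k ∈ Finset.Icc 1 ell) :
    node ell (ell + 1 - k) = √2 - node ell k := by
  rw [node_eq, node_eq, chebPoint_reflect hk]
  ring

theorem chebyshev_T_eq_prod (ell : ℕ) : Chebyshev.T ℝ ell =
    C (2 ^ (ell - 1)) * ∏ k ∈ Finset.Icc 1 ell, (X - C (chebPoint ell k)) := by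
  have hroots : (Chebyshev.T ℝ ell).roots = ((Finset.Icc 1 ell).image (chebPoint ell)).val := by
    rw [Chebyshev.roots_T_real]
    congr 1
    ext x
    simp only [Finset.mem_image, Finset.mem_range]
    constructor
    · rintro ⟨k, hk, rfl⟩
      have hm : ell - k ∈ Finset.Icc 1 ell := by
        rw [Finset.mem_Icc]
        omega
      refine ⟨ell - k, hm, ?_⟩
      rw [chebPoint_eq_range hm, Nat.sub_sub_self hk.le]
    · rintro ⟨k, hk, rfl⟩
      refine ⟨ell - k, ?_, (chebPoint_eq_range hk).symm⟩
      rw [Finset.mem_Icc] at hk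
      omega
  have hcard : Multiset.card (Chebyshev.T ℝ ell).roots = (Chebyshev.T ℝ ell).natDegree := by
    rw [hroots, Finset.card_val, Finset.card_image_of_injOn (chebPoint_injOn ell),
      Chebyshev.natDegree_T]
    simp
  have := C_leadingCoeff_mul_prod_multiset_X_sub_C hcard
  rw [← this, hroots, Chebyshev.leadingCoeff_T]
  congr 1
  exact Finset.prod_image (chebPoint_injOn ell)

/-- At a root cos θ of T_ℓ the angle ℓθ is an odd multiple of π/2, so |U_{ℓ-1}(cos θ) sin θ| = |sin
ℓθ| = 1. -/
theorem one_le_abs_U_chebPoint {ell k : ℕ} (hk : k ∈ Finset.Icc 1 ell) :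
    1 ≤ |(Chebyshev.U ℝ (ell - 1)).eval (chebPoint ell k)| := by
  have hm := Finset.mem_Icc.1 hk
  have hl : (ell : ℝ) ≠ 0 := by
    have : 0 < ell := by omega
    positivity
  rw [chebPoint_eq_range hk]
  set θ := (2 * ((ell - k : ℕ) : ℝ) + 1) * Real.pi / (2 * ell) with hθ
  have h := Chebyshev.U_real_cos θ (ell - 1)
  have h2 : (((ell : ℤ) - 1 : ℤ) + 1 : ℝ) * θ = ((ell - k : ℕ) : ℤ) * Real.pi + Real.pi / 2 := by
    rw [hθ]
    push_cast
    field_simp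
    ring
  rw [h2, Real.sin_add_pi_div_two] at h
  have h3 : |Real.cos (((ell - k : ℕ) : ℤ) * Real.pi)| = 1 := Real.abs_cos_int_mul_pi _
  rw [← h, abs_mul] at h3
  nlinarith [Real.abs_sin_le_one θ, abs_nonneg (Real.sin θ),
    abs_nonneg ((Chebyshev.U ℝ (ell - 1)).eval (Real.cos θ))]

/-- The right side is |T_ℓ'| at a root of T_ℓ, computed from the factorization, and T_ℓ' = ℓ
U_{ℓ-1}. -/
theorem prod_erase_abs_chebPoint_sub {ell k : ℕ} (hk : k ∈ Finset.Icc 1 ell) :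
    (ell : ℝ) ≤ 2 ^ (ell - 1) *
      ∏ j ∈ (Finset.Icc 1 ell).erase k, |chebPoint ell k - chebPoint ell j| := by
  have hm := Finset.mem_Icc.1 hk
  have h1 := congrArg (fun p => (derivative p).eval (chebPoint ell k))
    (chebyshev_T_eq_prod ell)
  simp only [Chebyshev.T_derivative_eq_U] at h1
  rw [← Finset.mul_prod_erase _ _ hk] at h1
  simp only [derivative_mul, derivative_C, derivative_sub, derivative_X, eval_mul, eval_add,
    eval_C, eval_sub, eval_X, eval_prod, sub_self, zero_mul, add_zero, zero_add, sub_zero,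
    one_mul] at h1
  have h2 := congrArg abs h1
  rw [abs_mul, abs_mul, Finset.abs_prod, abs_of_pos (by positivity : (0 : ℝ) < 2 ^ (ell - 1))] at h2
  rw [← h2]
  have := one_le_abs_U_chebPoint hk
  simp only [Int.cast_natCast, eval_natCast, Nat.abs_cast]
  nlinarith [Nat.cast_nonneg (α := ℝ) ell]

theorem prod_erase_abs_node_sub {ell k : ℕ} (hk : k ∈ Finset.Icc 1 ell) :
    4 * (ell : ℝ) ≤ 4 ^ ell * ∏ j ∈ (Finset.Icc 1 ell).erase k, |node ell j - node ell k| := by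
  have hm := Finset.mem_Icc.1 hk
  have h := prod_erase_abs_chebPoint_sub hk
  have e : ∀ j, |node ell j - node ell k| = |chebPoint ell k - chebPoint ell j| * 2⁻¹ := by
    intro j
    rw [node_eq, node_eq, abs_sub_comm, ← sub_div, abs_div, div_eq_mul_inv]
    simp
  simp only [e]
  rw [Finset.prod_mul_distrib, Finset.prod_const, Finset.card_erase_of_mem hk, Nat.card_Icc]
  obtain ⟨m, rfl⟩ : ∃ m, ell = m + 1 := ⟨ell - 1, by omega⟩
  simp only [Nat.add_sub_cancel] at h ⊢
  have e2 : (4 : ℝ) ^ (m + 1) = 4 * (2 ^ m * 2 ^ m) := by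
    rw [← mul_pow]; norm_num; ring
  have e3 : (2 : ℝ) ^ m * 2⁻¹ ^ m = 1 := by rw [← mul_pow]; norm_num
  rw [e2]
  calc _ ≤ 4 * _ := mul_le_mul_of_nonneg_left h (by norm_num)
    _ = _ := by linear_combination (-4 * 2 ^ m * ∏ j ∈ (Finset.Icc 1 (m + 1)).erase k,
      |chebPoint (m + 1) k - chebPoint (m + 1) j|) * e3

/-- √2 = cosh(arsinh 1) and exp(arsinh 1) = 1 + √2, so the value is cosh(n arsinh 1). -/
theorem eval_T_sqrt_two_le (n : ℕ) : (Chebyshev.T ℝ n).eval √2 ≤ (1 + √2) ^ n := by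
  have h := Chebyshev.T_real_cosh (Real.arsinh 1) n
  have hc : Real.cosh (Real.arsinh 1) = √2 := by
    rw [Real.cosh_arsinh]; norm_num
  have he : Real.exp (Real.arsinh 1) = 1 + √2 := by
    rw [Real.exp_arsinh]; norm_num
  rw [hc] at h
  rw [h, ← he, ← Real.exp_nat_mul, Real.cosh_eq]
  have h0 : 0 ≤ Real.arsinh 1 := Real.arsinh_nonneg_iff.2 zero_le_one
  have : Real.exp (-((n : ℤ) * Real.arsinh 1)) ≤ Real.exp ((n : ℤ) * Real.arsinh 1) := by
    apply Real.exp_le_exp.2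
    push_cast
    nlinarith [mul_nonneg (Nat.cast_nonneg (α := ℝ) n) h0]
  push_cast at this ⊢
  linarith

theorem prod_Icc_reflect {M : Type*} [CommMonoid M] {ell : ℕ} {A : Finset ℕ}
    (hA : A ⊆ Finset.Icc 1 ell) (hs : ∀ k ∈ A, ell + 1 - k ∈ A) (f : ℕ → M) :
    ∏ k ∈ A, f (ell + 1 - k) = ∏ k ∈ A, f k := by
  refine Finset.prod_nbij' (fun k => ell + 1 - k) (fun k => ell + 1 - k) hs hs ?_ ?_ ?_
  · intro k hk
    have := Finset.mem_Icc.1 (hA hk)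
    omega
  · intro k hk
    have := Finset.mem_Icc.1 (hA hk)
    omega
  · intro k hk
    rfl

theorem Icc_reflect_mem {ell : ℕ} : ∀ k ∈ Finset.Icc 1 ell, ell + 1 - k ∈ Finset.Icc 1 ell := by
  intro k hk
  rw [Finset.mem_Icc] at hk ⊢
  omega

/-- By the reflection s ↦ √2 - s of the nodes, the product is T_ℓ(√2) up to powers of 2. -/
theorem prod_node_le (ell : ℕ) :
    ∏ k ∈ Finset.Icc 1 ell, node ell k ≤ 2 * ((1 + √2) / 4) ^ ell := by
  rcases Nat.eq_zero_or_pos ell with rfl | hl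
  · simp
  rw [← prod_Icc_reflect (Finset.Subset.refl _) Icc_reflect_mem]
  have h1 := congrArg (fun p => p.eval √2) (chebyshev_T_eq_prod ell)
  simp only [eval_mul, eval_C, eval_prod, eval_sub, eval_X] at h1
  have h2 := eval_T_sqrt_two_le ell
  have e : ∏ k ∈ Finset.Icc 1 ell, node ell (ell + 1 - k) =
      (∏ k ∈ Finset.Icc 1 ell, (√2 - chebPoint ell k)) * 2⁻¹ ^ ell := by
    rw [Finset.prod_congr rfl (g := fun k => (√2 - chebPoint ell k) * 2⁻¹), Finset.prod_mul_distrib]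
    · simp
    · intro k hk
      rw [node_reflect hk, node_eq]
      ring
  rw [e]
  rw [h1] at h2
  obtain ⟨m, rfl⟩ : ∃ m, ell = m + 1 := ⟨ell - 1, by omega⟩
  simp only [Nat.add_sub_cancel] at h2
  have h4 : (4 : ℝ) ^ (m + 1) = 2 * (2 ^ m * 2 ^ (m + 1)) := by
    rw [pow_succ 2 m, show (4 : ℝ) = 2 * 2 by norm_num, mul_pow]; ring
  rw [div_pow, inv_pow, ← div_eq_mul_inv, ← mul_div_assoc, div_le_div_iff₀ (by positivity)
    (by positivity), h4]
  have h5 : (0 : ℝ) < 2 ^ (m + 1) := by positivity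
  nlinarith

/-- With p = s(√2 - s), the product of the differences is x² - √2 x + p. It is at most p since 0 ≤ x
≤ 1 < √2. It is at least p - 1/2 ≥ -p because p ≥ δ(√2 - δ) = 1/4; this is where the value of δ
enters. -/
theorem abs_sub_node_mul_le {ell k : ℕ} (hk : k ∈ Finset.Icc 1 ell) {x : ℝ} (h0 : 0 ≤ x)
    (h1 : x ≤ 1) : |x - node ell k| * |x - node ell (ell + 1 - k)| ≤
      node ell k * node ell (ell + 1 - k) := by
  rw [node_reflect hk, ← abs_mul]
  have hd := delta_le_node ell k
  have hd' := delta_le_node ell (ell + 1 - k)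
  rw [node_reflect hk] at hd'
  set s := node ell k
  have hs2 : √2 * √2 = 2 := Real.mul_self_sqrt (by norm_num)
  have hlt : (1 : ℝ) < √2 := by
    rw [Real.lt_sqrt] <;> norm_num
  have hlt2 : √2 < 2 := by nlinarith
  unfold delta at hd hd'
  rw [abs_le]
  constructor
  · nlinarith [sq_nonneg (x - √2 / 2), mul_nonneg (sub_nonneg.2 hd) (sub_nonneg.2 hd')]
  · nlinarith [mul_nonneg h0 (sub_nonneg.2 h1)]

theorem prod_abs_sub_node_le {ell : ℕ} {A : Finset ℕ} (hA : A ⊆ Finset.Icc 1 ell)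
    (hs : ∀ k ∈ A, ell + 1 - k ∈ A) {x : ℝ} (h0 : 0 ≤ x) (h1 : x ≤ 1) :
    ∏ k ∈ A, |x - node ell k| ≤ ∏ k ∈ A, node ell k := by
  have h : (∏ k ∈ A, |x - node ell k|) ^ 2 ≤ (∏ k ∈ A, node ell k) ^ 2 := by
    rw [sq, sq]
    nth_rewrite 2 [← prod_Icc_reflect hA hs (fun k => |x - node ell k|)]
    nth_rewrite 2 [← prod_Icc_reflect hA hs (fun k => node ell k)]
    rw [← Finset.prod_mul_distrib, ← Finset.prod_mul_distrib]
    exact Finset.prod_le_prod (fun k _ => by positivity)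
      fun k hk => abs_sub_node_mul_le (hA hk) h0 h1
  exact (pow_le_pow_iff_left₀ (Finset.prod_nonneg fun _ _ => abs_nonneg _)
    (Finset.prod_nonneg fun k _ => (node_pos ell k).le) two_ne_zero).1 h

/-- The pairing needs an index set closed under reflection, so the mirror index k' of k is removed
too. The omitted factors cost only 2/δ²; when k is its own mirror (the middle node), nothing more is
removed. -/
theorem prod_erase_abs_sub_node_le {ell k : ℕ} (hk : k ∈ Finset.Icc 1 ell) {x : ℝ} (h0 : 0 ≤ x)
    (h1 : x ≤ 1) : ∏ j ∈ (Finset.Icc 1 ell).erase k, |x - node ell j| ≤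
      2 / delta ^ 2 * ∏ j ∈ Finset.Icc 1 ell, node ell j := by
  set k' := ell + 1 - k with hk'
  have hm := Finset.mem_Icc.1 hk
  set A := ((Finset.Icc 1 ell).erase k).erase k' with hAdef
  have hA : A ⊆ Finset.Icc 1 ell := (Finset.erase_subset _ _).trans (Finset.erase_subset _ _)
  have hs : ∀ j ∈ A, ell + 1 - j ∈ A := by
    intro j hj
    simp only [hAdef, Finset.mem_erase, Finset.mem_Icc] at hj ⊢
    omega
  have hAle := prod_abs_sub_node_le hA hs h0 h1
  have hd := delta_pos
  have hpos : ∀ B : Finset ℕ, 0 < ∏ j ∈ B, node ell j := fun B =>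
    Finset.prod_pos fun j _ => node_pos ell j
  have hsq : √2 < 2 := by
    rw [Real.sqrt_lt'] <;> norm_num
  have hd1 : delta < 1 := by
    unfold delta
    linarith
  have hall : ∏ j ∈ Finset.Icc 1 ell, node ell j =
      node ell k * ∏ j ∈ (Finset.Icc 1 ell).erase k, node ell j :=
    (Finset.mul_prod_erase _ _ hk).symm
  have hnk := delta_le_node ell k
  by_cases hmem : k' ∈ (Finset.Icc 1 ell).erase k
  · rw [← Finset.mul_prod_erase _ _ hmem]
    rw [← Finset.mul_prod_erase _ _ hmem] at hall
    have hb : |x - node ell k'| ≤ 2 := by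
      have := node_le ell k'
      have := node_pos ell k'
      rw [abs_le]
      constructor <;> linarith
    have hnk' := delta_le_node ell k'
    have hA0 : 0 ≤ ∏ j ∈ A, |x - node ell j| := Finset.prod_nonneg fun _ _ => abs_nonneg _
    have hp := hpos A
    have hdd : delta * delta ≤ node ell k * node ell k' :=
      mul_le_mul hnk hnk' hd.le (node_pos ell k).le
    rw [div_mul_eq_mul_div, le_div_iff₀ (by positivity), hall]
    calc |x - node ell k'| * (∏ j ∈ A, |x - node ell j|) * delta ^ 2 ≤
        2 * (∏ j ∈ A, node ell j) * delta ^ 2 :=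
          mul_le_mul_of_nonneg_right (mul_le_mul hb hAle hA0 zero_le_two) (sq_nonneg _)
      _ = 2 * ((∏ j ∈ A, node ell j) * (delta * delta)) := by ring
      _ ≤ 2 * ((∏ j ∈ A, node ell j) * (node ell k * node ell k')) :=
          mul_le_mul_of_nonneg_left (mul_le_mul_of_nonneg_left hdd hp.le) zero_le_two
      _ = _ := by ring
  · have hAe : A = (Finset.Icc 1 ell).erase k := Finset.erase_eq_of_notMem hmem
    rw [← hAe] at hall ⊢
    have hp := hpos A
    have hdd : delta ^ 2 ≤ 2 * node ell k := by nlinarith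
    rw [div_mul_eq_mul_div, le_div_iff₀ (by positivity), hall]
    calc (∏ j ∈ A, |x - node ell j|) * delta ^ 2 ≤ (∏ j ∈ A, node ell j) * (2 * node ell k) :=
          mul_le_mul hAle hdd (sq_nonneg _) hp.le
      _ = _ := by ring

end

/-! ### Pointwise bounds for the integrand and their integrable majorant. -/

section

open Filter Topology MeasureTheory Complex Set

/-- The integrand as a meromorphic function of a complex variable. -/
noncomputable def cIntegrand (C α : ℝ) (ell l : ℕ) (z t : ℂ) : ℂ :=
  z * ((C ^ α : ℝ) : ℂ) * t ^ l * cexp t / (C * cexp (t / α) + z) *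
    ∏ k ∈ Finset.Icc 1 ell, (z - node ell k) / (C * cexp (t / α) + node ell k)

theorem lineIntegrand_eq (C α : ℝ) (ell l : ℕ) (z : ℂ) (x : ℝ) :
    lineIntegrand C α ell l z x = cIntegrand C α ell l z x := by
  unfold lineIntegrand cIntegrand
  push_cast
  ring

theorem norm_const_mul_cexp_div {C : ℝ} (hC : 0 < C) (α : ℝ) (t : ℂ) :
    ‖(C : ℂ) * cexp (t / α)‖ = C * Real.exp (t.re / α) := by
  rw [norm_mul, norm_real, Real.norm_of_nonneg hC.le, norm_exp, div_ofReal_re]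

theorem kappa_pos {α : ℝ} {ell : ℕ} (hα : 0 < α) (h : α < ell + 1) : 0 < kappa α ell :=
  div_pos hα (by linarith)

/-- The denominator of κ is at most 2. This lets the height of the contour, at most 5α, be absorbed
as 10κ. -/
theorem le_two_mul_kappa {α : ℝ} {ell : ℕ} (hα : 0 < α) (h : α < ell + 1) (h' : ell ≤ α + 1) :
    α ≤ 2 * kappa α ell := by
  rw [kappa, mul_div_assoc', le_div_iff₀ (by linarith)]
  nlinarith

/-- The constant of the bounds of the integrand that comes from `C`. -/
noncomputable def scaleFactor (C α : ℝ) : ℝ := max 1 (C ^ α) * max 1 (C ^ (-2 : ℝ))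

theorem scaleFactor_pos (C α : ℝ) : 0 < scaleFactor C α :=
  mul_pos (lt_max_of_lt_left one_pos) (lt_max_of_lt_left one_pos)

section pointwise

variable {C α : ℝ} {ell l : ℕ} {z t : ℂ} {c m W : ℝ}

theorem norm_cIntegrand (hC : 0 < C) : ‖cIntegrand C α ell l z t‖ =
    ‖z‖ / ‖C * cexp (t / α) + z‖ * (C ^ α * Real.exp t.re) * ‖t‖ ^ l *
      ∏ k ∈ Finset.Icc 1 ell, ‖z - node ell k‖ / ‖C * cexp (t / α) + node ell k‖ := by
  have : 0 ≤ C ^ α := Real.rpow_nonneg hC.le _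
  simp only [cIntegrand, norm_mul, norm_div, norm_prod, norm_pow, norm_real, norm_exp,
    Real.norm_of_nonneg this]
  ring

theorem norm_cIntegrand_le_exp (hC : 0 < C) (hc : 0 < c)
    (h1 : c * ‖z‖ ≤ ‖C * cexp (t / α) + z‖)
    (h2 : ∀ k, node ell k ≤ m * ‖C * cexp (t / α) + node ell k‖)
    (hW : ∏ k ∈ Finset.Icc 1 ell, m * ‖z - node ell k‖ / node ell k ≤ W) :
    ‖cIntegrand C α ell l z t‖ ≤ W / c * scaleFactor C α * (‖t‖ ^ l * Real.exp t.re) := by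
  rw [norm_cIntegrand hC]
  have hCα : 0 ≤ C ^ α := Real.rpow_nonneg hC.le _
  have e1 : ‖z‖ / ‖C * cexp (t / α) + z‖ ≤ 1 / c := by
    rcases eq_or_ne ‖z‖ 0 with h0 | h0
    · rw [h0, zero_div]; positivity
    · have : 0 < ‖z‖ := lt_of_le_of_ne (norm_nonneg _) h0.symm
      rw [div_le_div_iff₀ (lt_of_lt_of_le (by positivity) h1) hc]
      linarith
  have e2 : ∏ k ∈ Finset.Icc 1 ell, ‖z - node ell k‖ / ‖C * cexp (t / α) + node ell k‖ ≤ W := by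
    refine le_trans (Finset.prod_le_prod (fun k _ => by positivity) fun k _ => ?_) hW
    have hk := node_pos ell k
    have h := h2 k
    have hpos : 0 < ‖C * cexp (t / α) + node ell k‖ := by
      refine lt_of_le_of_ne (norm_nonneg _) fun h0 => ?_
      rw [← h0, mul_zero] at h
      linarith
    rw [div_le_div_iff₀ hpos hk]
    nlinarith [norm_nonneg (z - node ell k)]
  have e3 : C ^ α ≤ scaleFactor C α := by
    unfold scaleFactor
    calc C ^ α ≤ max 1 (C ^ α) := le_max_right _ _
      _ ≤ _ := le_mul_of_one_le_right (zero_le_one.trans (le_max_left _ _)) (le_max_left _ _)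
  have hP : 0 ≤ ∏ k ∈ Finset.Icc 1 ell, ‖z - node ell k‖ / ‖C * cexp (t / α) + node ell k‖ :=
    Finset.prod_nonneg fun k _ => by positivity
  have := scaleFactor_pos C α
  calc _ ≤ 1 / c * (scaleFactor C α * Real.exp t.re) * ‖t‖ ^ l * W := by gcongr
    _ = _ := by ring

/-- For X = |C exp(t/α)| the numerator C^α e^{re t} is X^α and the ℓ + 1 denominators are each
comparable to X or larger. The quotient X^{α-ℓ-1} is C^{α-ℓ-1} exp(-re t/κ), and -2 ≤ α - ℓ - 1 < 0
explains the C^{-2} in `scaleFactor`. -/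
theorem norm_cIntegrand_le_exp_neg (hC : 0 < C) (hα : 0 < α) (hl : α < ell + 1)
    (hl' : ell ≤ α + 1) (hc : 0 < c) (hz : ‖z‖ ≤ 1)
    (h1 : c * ‖(C : ℂ) * cexp (t / α)‖ ≤ ‖C * cexp (t / α) + z‖)
    (h2 : ∀ k, ‖(C : ℂ) * cexp (t / α)‖ ≤ m * ‖C * cexp (t / α) + node ell k‖)
    (hW : ∏ k ∈ Finset.Icc 1 ell, m * ‖z - node ell k‖ ≤ W) :
    ‖cIntegrand C α ell l z t‖ ≤
      W / c * scaleFactor C α * (‖t‖ ^ l * Real.exp (-t.re / kappa α ell)) := by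
  rw [norm_cIntegrand hC]
  have hX := norm_const_mul_cexp_div hC α t
  set X := C * Real.exp (t.re / α) with hXdef
  have hXpos : 0 < X := by positivity
  rw [hX] at h1
  have hCα : 0 ≤ C ^ α := Real.rpow_nonneg hC.le _
  have e1 : ‖z‖ / ‖C * cexp (t / α) + z‖ ≤ 1 / (c * X) := by
    have : 0 < c * X := by positivity
    rw [div_le_div_iff₀ (this.trans_le h1) this]
    nlinarith [norm_nonneg z]
  have e2 : ∏ k ∈ Finset.Icc 1 ell, ‖z - node ell k‖ / ‖C * cexp (t / α) + node ell k‖ ≤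
      W / X ^ ell := by
    have : ∏ k ∈ Finset.Icc 1 ell, ‖z - node ell k‖ / ‖C * cexp (t / α) + node ell k‖ ≤
        ∏ k ∈ Finset.Icc 1 ell, m * ‖z - node ell k‖ / X := by
      refine Finset.prod_le_prod (fun k _ => by positivity) fun k _ => ?_
      have h := h2 k
      rw [hX] at h
      have hpos : 0 < ‖C * cexp (t / α) + node ell k‖ := by
        refine lt_of_le_of_ne (norm_nonneg _) fun h0 => ?_
        rw [← h0, mul_zero] at h
        linarith
      rw [div_le_div_iff₀ hpos hXpos]
      nlinarith [norm_nonneg (z - node ell k)]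
    refine this.trans ?_
    rw [Finset.prod_div_distrib, Finset.prod_const, Nat.card_Icc, Nat.add_sub_cancel]
    gcongr
  have hP : 0 ≤ ∏ k ∈ Finset.Icc 1 ell, ‖z - node ell k‖ / ‖C * cexp (t / α) + node ell k‖ :=
    Finset.prod_nonneg fun k _ => by positivity
  have hW0 : 0 ≤ W := by
    have := hP.trans e2
    by_contra! hneg
    exact absurd this (not_le.2 (div_neg_of_neg_of_pos hneg (by positivity)))
  have e3 : C ^ α * Real.exp t.re = X ^ α := by
    rw [hXdef, Real.mul_rpow hC.le (Real.exp_pos _).le, ← Real.exp_mul, div_mul_cancel₀ _ hα.ne']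
  have e4 : X ^ α / (X * X ^ ell) =
      C ^ (α - (ell + 1)) * Real.exp (-t.re / kappa α ell) := by
    rw [← pow_succ', ← Real.rpow_natCast, ← Real.rpow_sub hXpos, hXdef,
      Real.mul_rpow hC.le (Real.exp_pos _).le, ← Real.exp_mul]
    push_cast
    congr 2
    unfold kappa
    have : (ell : ℝ) + 1 - α ≠ 0 := by linarith
    field_simp
    ring
  have e5 : C ^ (α - (ell + 1)) ≤ max 1 (C ^ (-2 : ℝ)) := by
    rcases le_total 1 C with h | h
    · exact (Real.rpow_le_one_of_one_le_of_nonpos h (by linarith)).trans (le_max_left _ _)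
    · exact (Real.rpow_le_rpow_of_exponent_ge hC h (by linarith)).trans (le_max_right _ _)
  have e6 : C ^ (α - (ell + 1)) ≤ scaleFactor C α := by
    unfold scaleFactor
    exact e5.trans
      (le_mul_of_one_le_left (zero_le_one.trans (le_max_left _ _)) (le_max_left _ _))
  rw [e3]
  have hXa : 0 ≤ X ^ α := by positivity
  calc _ ≤ 1 / (c * X) * X ^ α * ‖t‖ ^ l * (W / X ^ ell) := by gcongr
    _ = W / c * (X ^ α / (X * X ^ ell)) * ‖t‖ ^ l := by field_simp
    _ = W / c * (C ^ (α - (ell + 1)) * Real.exp (-t.re / kappa α ell)) * ‖t‖ ^ l := by rw [e4]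
    _ ≤ W / c * (scaleFactor C α * Real.exp (-t.re / kappa α ell)) * ‖t‖ ^ l := by gcongr
    _ = _ := by ring

end pointwise

/-- An integrable majorant of `(|x| + 10 κ) ^ l * min (exp x) (exp (-x / κ))`. -/
noncomputable def envelope (κ : ℝ) (l : ℕ) (x : ℝ) : ℝ :=
  if x ≤ 0 then (2 + 10 * κ) ^ l * Real.exp (1 / 2 * x)
  else (12 * κ) ^ l * Real.exp (-(1 / (2 * κ)) * x)

section envelope

variable {κ : ℝ} {l : ℕ}

theorem envelope_eqOn_Iic : EqOn (envelope κ l)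
    (fun x => (2 + 10 * κ) ^ l * Real.exp (1 / 2 * x)) (Iic 0) := fun _ hx => if_pos hx

theorem envelope_eqOn_Ioi : EqOn (envelope κ l)
    (fun x => (12 * κ) ^ l * Real.exp (-(1 / (2 * κ)) * x)) (Ioi 0) :=
  fun _ hx => if_neg (not_le.2 hx)

theorem integrable_envelope (hκ : 0 < κ) : Integrable (envelope κ l) := by
  rw [← integrableOn_univ, ← Iic_union_Ioi (a := (0 : ℝ))]
  refine IntegrableOn.union ?_ ?_
  · exact (integrableOn_congr_fun envelope_eqOn_Iic measurableSet_Iic).2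
      ((integrableOn_exp_mul_Iic (by norm_num) 0).const_mul _)
  · exact (integrableOn_congr_fun envelope_eqOn_Ioi measurableSet_Ioi).2
      ((integrableOn_exp_mul_Ioi (by simpa using hκ) 0).const_mul _)

theorem integral_envelope_le (hκ : 0 < κ) (hl : l = 0 ∨ l = 1) :
    ∫ x, envelope κ l x ≤ 48 * (1 + κ ^ (l + 1)) := by
  rw [← intervalIntegral.integral_Iic_add_Ioi (integrable_envelope hκ).integrableOn
    (integrable_envelope hκ).integrableOn (b := 0),
    setIntegral_congr_fun measurableSet_Iic envelope_eqOn_Iic,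
    setIntegral_congr_fun measurableSet_Ioi envelope_eqOn_Ioi, integral_const_mul,
    integral_const_mul, integral_exp_mul_Iic (by norm_num), integral_exp_mul_Ioi (by simpa using hκ)]
  simp only [mul_zero, Real.exp_zero]
  have : -1 / -(1 / (2 * κ)) = 2 * κ := by field_simp
  rw [this]
  rcases hl with rfl | rfl
  · norm_num; linarith
  · norm_num; nlinarith [sq_nonneg (κ - 1)]

theorem exp_neg_mul_abs_le {c : ℝ} (hc : 0 < c) (x : ℝ) :
    Real.exp (-(c * |x|)) ≤ max 1 (2 / c ^ 2) * (1 + x ^ 2)⁻¹ := by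
  have h := Real.quadratic_le_exp_of_nonneg (x := c * |x|) (by positivity)
  rw [mul_pow, sq_abs] at h
  have hx : 0 ≤ c * |x| := by positivity
  rw [Real.exp_neg, ← div_eq_mul_inv, inv_eq_one_div,
    div_le_div_iff₀ (Real.exp_pos _) (by positivity)]
  have h1 : 1 ≤ max 1 (2 / c ^ 2) := le_max_left _ _
  have h2 : 2 / c ^ 2 ≤ max 1 (2 / c ^ 2) := le_max_right _ _
  rw [div_le_iff₀ (by positivity)] at h2
  nlinarith [sq_nonneg x]

theorem exists_envelope_le (hκ : 0 < κ) : ∃ M, ∀ x, envelope κ l x ≤ M * (1 + x ^ 2)⁻¹ := by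
  refine ⟨(2 + 10 * κ) ^ l * max 1 (2 / (1 / 2) ^ 2) +
    (12 * κ) ^ l * max 1 (2 / (1 / (2 * κ)) ^ 2), fun x => ?_⟩
  have h1 := exp_neg_mul_abs_le (c := 1 / 2) (by norm_num) x
  have h2 := exp_neg_mul_abs_le (c := 1 / (2 * κ)) (by positivity) x
  have p1 : 0 ≤ (2 + 10 * κ) ^ l := by positivity
  have p2 : 0 ≤ (12 * κ) ^ l := by positivity
  rw [add_mul, mul_assoc, mul_assoc]
  unfold envelope
  split_ifs with hx
  · rw [abs_of_nonpos hx] at h1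
    refine le_trans (mul_le_mul_of_nonneg_left (le_trans (le_of_eq ?_) h1) p1)
      (le_add_of_nonneg_right (by positivity))
    congr 1
    ring
  · rw [abs_of_pos (not_le.1 hx)] at h2
    refine le_trans (mul_le_mul_of_nonneg_left (le_trans (le_of_eq ?_) h2) p2)
      (le_add_of_nonneg_left (by positivity))
    congr 1
    ring

theorem le_two_mul_exp_half (v : ℝ) : v ≤ 2 * Real.exp (v / 2) := by
  have := Real.add_one_le_exp (v / 2)
  linarith

/-- Combination of a bound at `-∞` and a bound at `+∞` into one by the envelope. -/
theorem le_mul_envelope (hκ : 0 < κ) (hl : l = 0 ∨ l = 1) {A r v x : ℝ} (hA : 0 ≤ A)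
    (hrx : r ≤ |x| + 10 * κ) (h1 : v ≤ A * (r ^ l * Real.exp x))
    (h2 : v ≤ A * (r ^ l * Real.exp (-x / κ))) : v ≤ A * envelope κ l x := by
  unfold envelope
  split_ifs with hx
  · refine h1.trans (mul_le_mul_of_nonneg_left ?_ hA)
    have e : Real.exp x = Real.exp (1 / 2 * x) * Real.exp (1 / 2 * x) := by
      rw [← Real.exp_add]; congr 1; ring
    rw [e, ← mul_assoc]
    refine mul_le_mul_of_nonneg_right ?_ (Real.exp_pos _).le
    have hle : Real.exp (1 / 2 * x) ≤ 1 := Real.exp_le_one_iff.2 (by linarith)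
    rcases hl with rfl | rfl
    · simpa only [pow_zero, one_mul] using hle
    · rw [pow_one, pow_one]
      -- Half of the exponent absorbs the linear factor: -x exp(x/2) ≤ 2 for x ≤ 0.
      rw [abs_of_nonpos hx] at hrx
      have h3 := le_two_mul_exp_half (-x)
      have h4 : Real.exp (-x / 2) * Real.exp (1 / 2 * x) = 1 := by
        rw [← Real.exp_add, show -x / 2 + 1 / 2 * x = 0 by ring, Real.exp_zero]
      have h5 := Real.exp_pos (1 / 2 * x)
      nlinarith
  · have hx := not_le.1 hx
    refine h2.trans (mul_le_mul_of_nonneg_left ?_ hA)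
    have e : Real.exp (-x / κ) = Real.exp (-(1 / (2 * κ)) * x) * Real.exp (-(1 / (2 * κ)) * x) := by
      rw [← Real.exp_add]; congr 1; field_simp; ring
    rw [e, ← mul_assoc]
    refine mul_le_mul_of_nonneg_right ?_ (Real.exp_pos _).le
    have hle : Real.exp (-(1 / (2 * κ)) * x) ≤ 1 := by
      refine Real.exp_le_one_iff.2 ?_
      have : 0 < 1 / (2 * κ) * x := by positivity
      linarith
    rcases hl with rfl | rfl
    · simpa only [pow_zero, one_mul] using hle
    · rw [pow_one, pow_one]
      rw [abs_of_pos hx] at hrx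
      have h3 := le_two_mul_exp_half (x / κ)
      rw [div_le_iff₀ hκ] at h3
      have h4 : Real.exp (x / κ / 2) * Real.exp (-(1 / (2 * κ)) * x) = 1 := by
        rw [← Real.exp_add, show x / κ / 2 + -(1 / (2 * κ)) * x = 0 by field_simp; ring,
          Real.exp_zero]
      have h5 := Real.exp_pos (-(1 / (2 * κ)) * x)
      have h6 : x * Real.exp (-(1 / (2 * κ)) * x) ≤ 2 * κ := by
        calc x * Real.exp (-(1 / (2 * κ)) * x) ≤
            2 * Real.exp (x / κ / 2) * κ * Real.exp (-(1 / (2 * κ)) * x) :=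
              mul_le_mul_of_nonneg_right h3 h5.le
          _ = 2 * κ * (Real.exp (x / κ / 2) * Real.exp (-(1 / (2 * κ)) * x)) := by ring
          _ = _ := by rw [h4, mul_one]
      nlinarith

end envelope

theorem norm_cIntegrand_le_envelope {C α c m W : ℝ} {ell l : ℕ} {z t : ℂ} (hC : 0 < C)
    (hα : 0 < α) (hl : α < ell + 1) (hl' : ell ≤ α + 1) (hl01 : l = 0 ∨ l = 1) (hc : 0 < c)
    (hz : ‖z‖ ≤ 1) (hm : 0 ≤ m) (him : |t.im| ≤ 5 * α)
    (h1 : c * max ‖(C : ℂ) * cexp (t / α)‖ ‖z‖ ≤ ‖C * cexp (t / α) + z‖)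
    (h2 : ∀ k, max ‖(C : ℂ) * cexp (t / α)‖ (node ell k) ≤
      m * ‖C * cexp (t / α) + node ell k‖)
    (hW : ∏ k ∈ Finset.Icc 1 ell, m * ‖z - node ell k‖ / node ell k ≤ W)
    (hW' : ∏ k ∈ Finset.Icc 1 ell, m * ‖z - node ell k‖ ≤ W) :
    ‖cIntegrand C α ell l z t‖ ≤ W / c * scaleFactor C α * envelope (kappa α ell) l t.re := by
  have hκ := kappa_pos hα hl
  have hακ := le_two_mul_kappa hα hl hl'
  have hW0 : 0 ≤ W := le_trans (Finset.prod_nonneg fun k _ => by positivity) hW'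
  have := scaleFactor_pos C α
  refine le_mul_envelope hκ hl01 (by positivity) ?_
    (norm_cIntegrand_le_exp hC hc ?_ ?_ hW) (norm_cIntegrand_le_exp_neg hC hα hl hl' hc hz ?_ ?_ hW')
  · have := norm_le_abs_re_add_abs_im t
    linarith
  · exact le_trans (mul_le_mul_of_nonneg_left (le_max_right _ _) hc.le) h1
  · exact fun k => (le_max_right _ _).trans (h2 k)
  · exact le_trans (mul_le_mul_of_nonneg_left (le_max_left _ _) hc.le) h1
  · exact fun k => (le_max_left _ _).trans (h2 k)

end

/-! ### Poles of the integrand and the shifted Fourier integral. -/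

section

open Filter Topology MeasureTheory Complex Set

/-- The solution of `C exp (t / α) = -s` with `0 < im t < 2 π α`. -/
noncomputable def pole (C α : ℝ) (s : ℂ) : ℂ := α * (log s + Real.pi * I - Real.log C)

theorem pole_im (C α : ℝ) (s : ℂ) : (pole C α s).im = α * (arg s + Real.pi) := by
  simp [pole, log_im]

theorem pole_re (C α : ℝ) (s : ℂ) : (pole C α s).re = α * (Real.log ‖s‖ - Real.log C) := by
  simp [pole, log_re]

theorem const_mul_cexp_pole {C α : ℝ} (hC : 0 < C) (hα : 0 < α) {s : ℂ} (hs : s ≠ 0) :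
    (C : ℂ) * cexp (pole C α s / α) = -s := by
  have h : (α : ℂ) ≠ 0 := by exact_mod_cast hα.ne'
  rw [pole, mul_div_cancel_left₀ _ h, exp_sub, exp_add, exp_log hs, exp_pi_mul_I, ← ofReal_exp,
    Real.exp_log hC]
  have : (C : ℂ) ≠ 0 := by exact_mod_cast hC.ne'
  field_simp

theorem eq_pole_of_const_mul_cexp_eq {C α : ℝ} (hC : 0 < C) (hα : 0 < α) {s t : ℂ}
    (hs : s ∈ slitPlane) (h0 : 0 ≤ t.im) (h1 : t.im < 2 * Real.pi * α)
    (h : (C : ℂ) * cexp (t / α) + s = 0) : t = pole C α s := by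
  have hs0 := slitPlane_ne_zero hs
  have hα' : (α : ℂ) ≠ 0 := by exact_mod_cast hα.ne'
  have h2 : cexp (t / α) = cexp (pole C α s / α) := by
    have hC' : (C : ℂ) ≠ 0 := by exact_mod_cast hC.ne'
    apply mul_left_cancel₀ hC'
    rw [const_mul_cexp_pole hC hα hs0]
    linear_combination h
  obtain ⟨n, hn⟩ := exp_eq_exp_iff_exists_int.1 h2
  have h3 : t = pole C α s + α * (n * (2 * Real.pi * I)) := by
    field_simp at hn
    linear_combination hn
  have him := congrArg Complex.im h3
  rw [add_im, pole_im] at him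
  simp at him
  have ha1 := neg_pi_lt_arg s
  have ha2 : arg s < Real.pi := lt_of_le_of_ne (arg_le_pi s) (mem_slitPlane_iff_arg.1 hs).1
  have hpi := Real.pi_pos
  have him' : t.im = α * (arg s + Real.pi + 2 * Real.pi * n) := by rw [him]; ring
  have g1 : 0 ≤ arg s + Real.pi + 2 * Real.pi * n := by
    by_contra! hneg
    nlinarith
  have g2 : arg s + Real.pi + 2 * Real.pi * n < 2 * Real.pi := by
    rw [him'] at h1
    by_contra! hneg
    nlinarith
  have n1 : (-1 : ℝ) < n := by
    by_contra! hneg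
    nlinarith
  have n2 : (n : ℝ) < 1 := by
    by_contra! hneg
    nlinarith
  have : n = 0 := by
    have n1' : (-1 : ℤ) < n := by exact_mod_cast n1
    have n2' : n < (1 : ℤ) := by exact_mod_cast n2
    omega
  rw [h3, this]
  simp

/-- The derivative of the denominator at its zero is C exp(t/α)/α = -s/α, which is nonzero; the pole
is therefore simple. -/
theorem tendsto_sub_pole_mul_inv {C α : ℝ} (hC : 0 < C) (hα : 0 < α) {s : ℂ} (hs : s ≠ 0) :
    Tendsto (fun t => (t - pole C α s) * (C * cexp (t / α) + s)⁻¹) (𝓝[≠] pole C α s)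
      (𝓝 (-α / s)) := by
  have hα' : (α : ℂ) ≠ 0 := by exact_mod_cast hα.ne'
  have hd : HasDerivAt (fun t : ℂ => (C : ℂ) * cexp (t / α) + s) (-s / α) (pole C α s) := by
    have h1 : HasDerivAt (fun t : ℂ => t / α) (1 / α) (pole C α s) := (hasDerivAt_id _).div_const _
    have h2 := (h1.cexp.const_mul (C : ℂ)).add_const s
    refine h2.congr_deriv ?_
    rw [← mul_assoc, const_mul_cexp_pole hC hα hs]
    ring
  have h3 := (hasDerivAt_iff_tendsto_slope.1 hd).inv₀ (div_ne_zero (neg_ne_zero.2 hs) hα')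
  have e : (-s / (α : ℂ))⁻¹ = -α / s := by field_simp
  rw [e] at h3
  refine h3.congr' ?_
  filter_upwards with t
  rw [slope_def_field, const_mul_cexp_pole hC hα hs, neg_add_cancel, sub_zero, inv_div,
    div_eq_mul_inv]

theorem tendsto_sub_pole_mul_prod_inv {C α : ℝ} (hC : 0 < C) (hα : 0 < α) {S : Finset ℂ} {s : ℂ}
    (hsS : s ∈ S) (hs : s ≠ 0) {N : ℂ → ℂ} (hN : ContinuousAt N (pole C α s)) :
    Tendsto (fun t => (t - pole C α s) * (N t * ∏ w ∈ S, (C * cexp (t / α) + w)⁻¹))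
      (𝓝[≠] pole C α s)
      (𝓝 (N (pole C α s) * (-α / s * ∏ w ∈ S.erase s, (w - s)⁻¹))) := by
  have h1 := tendsto_sub_pole_mul_inv hC hα hs
  have h2 : Tendsto (fun t : ℂ => ∏ w ∈ S.erase s, ((C : ℂ) * cexp (t / α) + w)⁻¹)
      (𝓝[≠] pole C α s) (𝓝 (∏ w ∈ S.erase s, (w - s)⁻¹)) := by
    refine tendsto_finsetProd _ fun w hw => Tendsto.mono_left ?_ nhdsWithin_le_nhds
    have hne : w - s ≠ 0 := sub_ne_zero.2 (Finset.ne_of_mem_erase hw)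
    have hc : ContinuousAt (fun t : ℂ => (C : ℂ) * cexp (t / α) + w) (pole C α s) := by fun_prop
    have ht := hc.tendsto
    simp only [const_mul_cexp_pole hC hα hs, neg_add_eq_sub] at ht
    exact ht.inv₀ hne
  have h3 := (hN.tendsto.mono_left nhdsWithin_le_nhds).mul (h1.mul h2)
  refine h3.congr fun t => ?_
  rw [← Finset.mul_prod_erase S _ hsS]
  ring

/-- The points `-E` at which the rational factor of the integrand has a pole `E`. -/
noncomputable def singSet (ell : ℕ) (z : ℂ) : Finset ℂ :=
  insert z ((Finset.Icc 1 ell).image fun k => (node ell k : ℂ))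

/-- The entire factor of the integrand. -/
noncomputable def entireFactor (C α : ℝ) (ell l : ℕ) (z t : ℂ) : ℂ :=
  (z * ∏ k ∈ Finset.Icc 1 ell, (z - node ell k)) * (((C ^ α : ℝ) : ℂ) * t ^ l * cexp t)

theorem nodeC_injOn (ell : ℕ) : Set.InjOn (fun k => (node ell k : ℂ)) (Finset.Icc 1 ell) :=
  fun _ hi _ hj h => node_injOn ell hi hj (ofReal_injective h)

theorem cIntegrand_eq {C α : ℝ} {ell l : ℕ} {z : ℂ} (hz : ∀ k ∈ Finset.Icc 1 ell, z ≠ node ell k)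
    (t : ℂ) : cIntegrand C α ell l z t =
      entireFactor C α ell l z t * ∏ w ∈ singSet ell z, (C * cexp (t / α) + w)⁻¹ := by
  have hmem : z ∉ (Finset.Icc 1 ell).image fun k => (node ell k : ℂ) := by
    simp only [Finset.mem_image, not_exists, not_and]
    exact fun k hk h => hz k hk h.symm
  rw [singSet, Finset.prod_insert hmem, Finset.prod_image (nodeC_injOn ell)]
  simp only [cIntegrand, entireFactor, div_eq_mul_inv, Finset.prod_mul_distrib]
  ring

theorem differentiable_entireFactor (C α : ℝ) (ell l : ℕ) (z : ℂ) :
    Differentiable ℂ (entireFactor C α ell l z) := by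
  unfold entireFactor
  fun_prop

/-- The norm of the residue of the integrand at `pole C α s`. -/
noncomputable def residueNorm (C α : ℝ) (ell l : ℕ) (z s : ℂ) : ℝ :=
  ‖entireFactor C α ell l z (pole C α s)‖ *
    (α / ‖s‖ * ∏ w ∈ (singSet ell z).erase s, ‖w - s‖⁻¹)

theorem half_mul_max_le_norm_add {E s : ℂ} (h : (4 ≤ ‖E‖ ∧ ‖s‖ ≤ 2) ∨ ‖E‖ ≤ ‖s‖ / 2) :
    1 / 2 * max ‖E‖ ‖s‖ ≤ ‖E + s‖ := by
  have h1 : ‖E‖ - ‖s‖ ≤ ‖E + s‖ := norm_sub_le_norm_add E s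
  have h2 : ‖s‖ - ‖E‖ ≤ ‖E + s‖ := by
    have := norm_sub_le_norm_add s E
    rwa [add_comm] at this
  rcases h with ⟨h3, h4⟩ | h3
  · rw [max_eq_left (by linarith)]
    linarith
  · rw [max_eq_right (by linarith [norm_nonneg s])]
    linarith

theorem norm_node (ell k : ℕ) : ‖(node ell k : ℂ)‖ = node ell k := by
  rw [norm_real, Real.norm_of_nonneg (node_pos ell k).le]

theorem sqrt_two_lt_two : √2 < 2 := by
  rw [Real.sqrt_lt'] <;> norm_num

/-- Far out in the strip |C exp(t/α)| is either at least 4 or much smaller than |z| and every node,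
so no denominator can cancel. Only the limit matters, hence W may depend arbitrarily on z and ℓ. -/
theorem tendsto_cIntegrand_stripEnds {C α a : ℝ} {ell l : ℕ} {z : ℂ} (hC : 0 < C)
    (hα : 0 < α) (hl : α < ell + 1) (hl' : ell ≤ α + 1) (hl01 : l = 0 ∨ l = 1)
    (hz : ‖z‖ ≤ 1) (hz0 : z ≠ 0) (ha : a ≤ 5 * α) :
    Tendsto (cIntegrand C α ell l z) (stripEnds a) (𝓝 0) := by
  have hκ := kappa_pos hα hl
  set W := max (∏ k ∈ Finset.Icc 1 ell, 2 * ‖z - node ell k‖ / node ell k)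
    (∏ k ∈ Finset.Icc 1 ell, 2 * ‖z - node ell k‖) with hW
  obtain ⟨M, hM⟩ := exists_envelope_le (l := l) hκ
  have hre : Tendsto (fun t : ℂ => |t.re|) (stripEnds a) atTop := tendsto_inf_left tendsto_comap
  have hW0 : 0 ≤ W := le_max_of_le_right (Finset.prod_nonneg fun k _ => by positivity)
  have hsf := scaleFactor_pos C α
  set η := min ‖z‖ delta / 2 with hη
  have hη0 : 0 < η := half_pos (lt_min (norm_pos_iff.2 hz0) delta_pos)
  have hlim : Tendsto (fun t : ℂ => W / (1 / 2) * scaleFactor C α * (M * (1 + |t.re| ^ 2)⁻¹))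
      (stripEnds a) (𝓝 0) := by
    have h1 : Tendsto (fun x : ℝ => 1 + x ^ 2) atTop atTop :=
      tendsto_atTop_add_const_left _ _ (tendsto_pow_atTop two_ne_zero)
    have h2 := ((tendsto_inv_atTop_zero.comp (h1.comp hre)).const_mul M).const_mul
      (W / (1 / 2) * scaleFactor C α)
    simpa using h2
  refine squeeze_zero_norm' ?_ hlim
  have hstrip : ∀ᶠ t in stripEnds a, 0 ≤ t.im ∧ t.im ≤ a :=
    mem_inf_of_right (mem_principal_self _)
  filter_upwards [hstrip, hre.eventually (eventually_ge_atTop (α * Real.log (4 / C))),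
    hre.eventually (eventually_ge_atTop (-(α * Real.log (η / C))))] with t ht h4 h5
  have hX := norm_const_mul_cexp_div hC α t
  have hcase : 4 ≤ ‖(C : ℂ) * cexp (t / α)‖ ∨ ‖(C : ℂ) * cexp (t / α)‖ ≤ η := by
    rw [hX]
    rcases le_total 0 t.re with h | h
    · left
      rw [abs_of_nonneg h, mul_comm α, ← le_div_iff₀ hα, Real.log_le_iff_le_exp (by positivity),
        div_le_iff₀ hC] at h4
      linarith
    · right
      rw [abs_of_nonpos h, neg_le_neg_iff, mul_comm α, ← div_le_iff₀ hα,
        Real.le_log_iff_exp_le (by positivity), le_div_iff₀ hC] at h5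
      linarith
  have h1 : 1 / 2 * max ‖(C : ℂ) * cexp (t / α)‖ ‖z‖ ≤ ‖C * cexp (t / α) + z‖ := by
    refine half_mul_max_le_norm_add (hcase.imp (fun h => ⟨h, by linarith⟩) fun h => h.trans ?_)
    rw [hη]
    gcongr
    exact min_le_left _ _
  have h2 : ∀ k, max ‖(C : ℂ) * cexp (t / α)‖ (node ell k) ≤
      2 * ‖C * cexp (t / α) + node ell k‖ := by
    intro k
    have hn2 : ‖(node ell k : ℂ)‖ ≤ 2 := by
      rw [norm_node]
      have := node_le ell k
      have := sqrt_two_lt_two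
      linarith
    have hnη : η ≤ ‖(node ell k : ℂ)‖ / 2 := by
      rw [hη, norm_node]
      gcongr
      exact (min_le_right _ _).trans (delta_le_node ell k)
    have := half_mul_max_le_norm_add (E := (C : ℂ) * cexp (t / α)) (s := node ell k)
      (hcase.imp (fun h => ⟨h, hn2⟩) fun h => h.trans hnη)
    rw [norm_node] at this
    linarith
  have := norm_cIntegrand_le_envelope hC hα hl hl' hl01 (by norm_num) hz zero_le_two
    (by rw [abs_of_nonneg ht.1]; exact ht.2.trans ha) h1 h2 (W := W) (le_max_left _ _)
    (le_max_right _ _)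
  refine this.trans ?_
  rw [sq_abs]
  gcongr
  exact hM _

/-- Shifting the contour of the Fourier integral to the line `im t = α φ`. -/
theorem norm_fourier_le_of_contour {C α φ c m W y : ℝ} {ell l : ℕ} {z : ℂ} (hC : 0 < C)
    (hα : 0 < α) (hl : α < ell + 1) (hl' : ell ≤ α + 1) (hl01 : l = 0 ∨ l = 1) (hc : 0 < c)
    (hz : ‖z‖ ≤ 1) (hslit : z ∈ slitPlane) (hzn : ∀ k ∈ Finset.Icc 1 ell, z ≠ node ell k)
    (hm : 0 < m) (hφ0 : 0 ≤ φ) (hφ5 : φ ≤ 5) (hy : 0 ≤ y)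
    (h1 : ∀ X : ℝ, 0 < X → c * max X ‖z‖ ≤ ‖X * cexp (φ * I) + z‖)
    (h2 : ∀ X : ℝ, 0 < X → ∀ k, max X (node ell k) ≤ m * ‖X * cexp (φ * I) + node ell k‖)
    (hW : ∏ k ∈ Finset.Icc 1 ell, m * ‖z - node ell k‖ / node ell k ≤ W)
    (hW' : ∏ k ∈ Finset.Icc 1 ell, m * ‖z - node ell k‖ ≤ W)
    (hint : Integrable (fun x : ℝ => cIntegrand C α ell l z x)) :
    ‖∫ x : ℝ, cIntegrand C α ell l z x * cexp (I * (y * x))‖ ≤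
      W / c * scaleFactor C α * (48 * (1 + kappa α ell ^ (l + 1))) * Real.exp (-(y * (α * φ))) +
      2 * Real.pi * ∑ s ∈ singSet ell z with α * (arg s + Real.pi) < α * φ,
        residueNorm C α ell l z s * Real.exp (-(y * (α * (arg s + Real.pi)))) := by
  have hκ := kappa_pos hα hl
  have hα' : (α : ℂ) ≠ 0 := by exact_mod_cast hα.ne'
  set F : ℂ → ℂ := fun t => cIntegrand C α ell l z t * cexp (I * (y * t)) with hF
  have hnexp : ∀ t : ℂ, ‖cexp (I * (y * t))‖ = Real.exp (-(y * t.im)) := by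
    intro t
    rw [norm_exp]
    simp
  have hslit' : ∀ s ∈ singSet ell z, s ∈ slitPlane := by
    intro s hs
    simp only [singSet, Finset.mem_insert, Finset.mem_image] at hs
    rcases hs with rfl | ⟨k, -, rfl⟩
    · exact hslit
    · exact ofReal_mem_slitPlane.2 (node_pos ell k)
  have hExp : ∀ x : ℝ, (C : ℂ) * cexp ((x + (α * φ : ℝ) * I) / α) =
      ((C * Real.exp (x / α) : ℝ) : ℂ) * cexp (φ * I) := by
    intro x
    push_cast
    rw [mul_assoc (C : ℂ), ← exp_add]
    congr 2
    field_simp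
  have hXpos : ∀ x : ℝ, 0 < C * Real.exp (x / α) := fun x => by positivity
  have hnX : ∀ x : ℝ, ‖((C * Real.exp (x / α) : ℝ) : ℂ) * cexp (φ * I)‖ =
      C * Real.exp (x / α) := by
    intro x
    rw [norm_mul, norm_exp_ofReal_mul_I, mul_one, norm_real, Real.norm_of_nonneg (hXpos x).le]
  have hline : ∀ x : ℝ, ‖F (x + (α * φ : ℝ) * I)‖ ≤
      W / c * scaleFactor C α * Real.exp (-(y * (α * φ))) * envelope (kappa α ell) l x := by
    intro x
    have hb := norm_cIntegrand_le_envelope (t := x + (α * φ : ℝ) * I) hC hα hl hl' hl01 hc hz hm.le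
      ?_ ?_ ?_ hW hW'
    · simp only [hF, norm_mul, hnexp]
      have him : ((x : ℂ) + (α * φ : ℝ) * I).im = α * φ := by simp
      have hre : ((x : ℂ) + (α * φ : ℝ) * I).re = x := by simp
      rw [hre] at hb
      rw [him]
      calc _ ≤ W / c * scaleFactor C α * envelope (kappa α ell) l x *
          Real.exp (-(y * (α * φ))) := mul_le_mul_of_nonneg_right hb (Real.exp_pos _).le
        _ = _ := by ring
    · have him : ((x : ℂ) + (α * φ : ℝ) * I).im = α * φ := by simp
      rw [him, abs_of_nonneg (by positivity)]
      nlinarith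
    · rw [hExp, hnX]
      exact h1 _ (hXpos x)
    · intro k
      rw [hExp, hnX]
      exact h2 _ (hXpos x) k
  have hne_line : ∀ t : ℂ, t.im = α * φ → ∀ s ∈ singSet ell z, (C : ℂ) * cexp (t / α) + s ≠ 0 := by
    intro t ht s hs
    have et : t = t.re + (α * φ : ℝ) * I := by
      rw [← ht]
      exact (re_add_im t).symm
    rw [et, hExp]
    simp only [singSet, Finset.mem_insert, Finset.mem_image] at hs
    rcases hs with rfl | ⟨k, -, rfl⟩
    · refine norm_pos_iff.1 (lt_of_lt_of_le ?_ (h1 _ (hXpos _)))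
      exact mul_pos hc (lt_max_of_lt_left (hXpos _))
    · have := h2 _ (hXpos t.re) k
      refine norm_pos_iff.1 (pos_of_mul_pos_right (lt_of_lt_of_le ?_ this) hm.le)
      exact lt_max_of_lt_left (hXpos _)
  have hdiff : ∀ t : ℂ, (∀ s ∈ singSet ell z, (C : ℂ) * cexp (t / α) + s ≠ 0) →
      DifferentiableAt ℂ F t := by
    intro t ht
    simp only [hF]
    refine DifferentiableAt.mul ?_ (by fun_prop)
    have e : cIntegrand C α ell l z = fun t =>
        entireFactor C α ell l z t * ∏ w ∈ singSet ell z, (C * cexp (t / α) + w)⁻¹ :=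
      funext fun t => cIntegrand_eq hzn t
    rw [e]
    refine (differentiable_entireFactor C α ell l z t).mul ?_
    refine DifferentiableAt.fun_finsetProd fun w hw => DifferentiableAt.inv (by fun_prop) (ht w hw)
  set P : Finset ℂ := ((singSet ell z).filter fun s =>
    α * (arg s + Real.pi) < α * φ).image (pole C α) with hP
  set N : ℂ → ℂ := fun t => entireFactor C α ell l z t * cexp (I * (y * t)) with hN
  have hpole_inj : Set.InjOn (pole C α) ((singSet ell z).filter fun s =>
      α * (arg s + Real.pi) < α * φ) := by
    intro s hs s' hs' h
    have h3 := const_mul_cexp_pole hC hα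
      (slitPlane_ne_zero (hslit' s (Finset.mem_filter.1 (Finset.mem_coe.1 hs)).1))
    rw [h, const_mul_cexp_pole hC hα
      (slitPlane_ne_zero (hslit' s' (Finset.mem_filter.1 (Finset.mem_coe.1 hs')).1))] at h3
    exact (neg_injective h3).symm
  have hint' : Integrable fun x : ℝ => F x := by
    refine hint.mul_bdd (c := 1) (by fun_prop) (ae_of_all _ fun x => ?_)
    rw [hnexp]
    simp
  have hcont_line : Continuous fun x : ℝ => F (x + (α * φ : ℝ) * I) := by
    rw [continuous_iff_continuousAt]
    intro x
    refine ContinuousAt.comp (g := F) (f := fun x : ℝ => (x : ℂ) + (α * φ : ℝ) * I) ?_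
      (by fun_prop)
    exact (hdiff _ (hne_line _ (by simp))).continuousAt
  have hint_line : Integrable fun x : ℝ => F (x + (α * φ : ℝ) * I) :=
    Integrable.mono' ((integrable_envelope hκ).const_mul _) hcont_line.aestronglyMeasurable
      (ae_of_all _ hline)
  have hlim : Tendsto F (stripEnds (α * φ)) (𝓝 0) := by
    refine squeeze_zero_norm' ?_ (tendsto_zero_iff_norm_tendsto_zero.1
      (tendsto_cIntegrand_stripEnds (l := l) (a := α * φ) hC hα hl hl' hl01 hz
        (slitPlane_ne_zero hslit) (by nlinarith)))
    have hstrip : ∀ᶠ t in stripEnds (α * φ), 0 ≤ t.im ∧ t.im ≤ α * φ :=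
      mem_inf_of_right (mem_principal_self _)
    filter_upwards [hstrip] with t ht
    simp only [hF, norm_mul, hnexp]
    refine mul_le_of_le_one_right (norm_nonneg _) (Real.exp_le_one_iff.2 ?_)
    have := mul_nonneg hy ht.1
    linarith
  -- The residue must be a function of the pole q; the root s is recovered from it as -C exp(q/α).
  set r : ℂ → ℂ := fun q => N q * (-α / (-(C * cexp (q / α))) *
    ∏ w ∈ (singSet ell z).erase (-(C * cexp (q / α))), (w - (-(C * cexp (q / α))))⁻¹) with hr
  have hrp : ∀ s ∈ singSet ell z, r (pole C α s) =
      N (pole C α s) * (-α / s * ∏ w ∈ (singSet ell z).erase s, (w - s)⁻¹) := by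
    intro s hs
    simp only [hr]
    rw [const_mul_cexp_pole hC hα (slitPlane_ne_zero (hslit' s hs)), neg_neg]
  have key := integral_line_sub_integral_line (a := α * φ) (by positivity) P r (F := F) ?_ ?_ ?_
    hlim hint' hint_line
  · have e1 : ∫ x : ℝ, cIntegrand C α ell l z x * cexp (I * (y * x)) =
        (∫ x : ℝ, F (x + (α * φ : ℝ) * I)) + 2 * Real.pi * I * ∑ p ∈ P, r p := by
      rw [← key]
      ring
    rw [e1]
    refine (norm_add_le _ _).trans (add_le_add ?_ ?_)
    · refine (norm_integral_le_of_norm_le ((integrable_envelope hκ).const_mul _)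
        (ae_of_all _ hline)).trans ?_
      rw [integral_const_mul]
      have hW0 : 0 ≤ W := le_trans (Finset.prod_nonneg fun k _ => by positivity) hW'
      have := scaleFactor_pos C α
      calc _ ≤ W / c * scaleFactor C α * Real.exp (-(y * (α * φ))) *
          (48 * (1 + kappa α ell ^ (l + 1))) := by
            gcongr
            exact integral_envelope_le hκ hl01
        _ = _ := by ring
    · rw [norm_mul, hP, Finset.sum_image hpole_inj]
      have : ‖(2 * Real.pi * I : ℂ)‖ = 2 * Real.pi := by
        simp [abs_of_pos Real.pi_pos]
      rw [this]
      refine mul_le_mul_of_nonneg_left ((norm_sum_le _ _).trans ?_) (by positivity)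
      refine Finset.sum_le_sum fun s hs => ?_
      rw [hrp s (Finset.mem_filter.1 hs).1]
      simp only [hN, norm_mul, norm_div, norm_neg, norm_prod, norm_inv, hnexp, residueNorm,
        pole_im, norm_real, Real.norm_of_nonneg hα.le]
      apply le_of_eq
      ring
  · intro p hp
    obtain ⟨s, hs, rfl⟩ := Finset.mem_image.1 hp
    rw [pole_im]
    refine ⟨mul_pos hα ?_, (Finset.mem_filter.1 hs).2⟩
    linarith [neg_pi_lt_arg s]
  · intro t h0 ha htP
    refine hdiff t fun s hs h => ?_
    have hpi := Real.pi_gt_three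
    -- Since φ ≤ 5 < 2π, the strip holds at most one solution for each s.
    have ht : t = pole C α s := eq_pole_of_const_mul_cexp_eq hC hα (hslit' s hs) h0
      (by nlinarith) h
    rcases eq_or_lt_of_le ha with hae | hlt
    · exact hne_line t hae s hs h
    · refine htP (Finset.mem_image.2 ⟨s, Finset.mem_filter.2 ⟨hs, ?_⟩, ht.symm⟩)
      rwa [← pole_im C, ← ht]
  · intro p hp
    obtain ⟨s, hs, rfl⟩ := Finset.mem_image.1 hp
    have hs' := (Finset.mem_filter.1 hs).1
    rw [hrp s hs']
    have hNc : ContinuousAt N (pole C α s) := by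
      have := (differentiable_entireFactor C α ell l z).continuous
      exact Continuous.continuousAt (by fun_prop)
    refine (tendsto_sub_pole_mul_prod_inv hC hα hs' (slitPlane_ne_zero (hslit' s hs')) hNc).congr
      fun t => ?_
    simp only [hF, hN, cIntegrand_eq hzn]
    ring

end

/-! ### Geometry of the sector. -/

section

open Filter Topology MeasureTheory Complex Set

section sector

variable {β : ℝ} {z : ℂ}

theorem exists_polar_of_mem_sector (hz : z ∈ sector β) :
    ∃ x ∈ Icc (0 : ℝ) 1, ∃ η : ℝ, |η| ≤ β * Real.pi / 2 ∧ z = x * cexp (η * I) := by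
  obtain ⟨x, hx, θ, hθ, h | h⟩ := hz
  · refine ⟨x, hx, θ * Real.pi / 2, ?_, by rw [h, mul_comm I]⟩
    rw [abs_of_nonneg (by have := hθ.1; positivity)]
    have := hθ.2
    gcongr
  · refine ⟨x, hx, -(θ * Real.pi / 2), ?_, by rw [h, mul_comm I, ofReal_neg, neg_mul]⟩
    rw [abs_neg, abs_of_nonneg (by have := hθ.1; positivity)]
    have := hθ.2
    gcongr

theorem norm_le_one_of_mem_sector (hz : z ∈ sector β) : ‖z‖ ≤ 1 := by
  obtain ⟨x, hx, η, -, rfl⟩ := exists_polar_of_mem_sector hz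
  rw [norm_mul, norm_exp_ofReal_mul_I, mul_one, norm_real, Real.norm_of_nonneg hx.1]
  exact hx.2

theorem conj_mem_sector (hz : z ∈ sector β) : (starRingEnd ℂ) z ∈ sector β := by
  obtain ⟨x, hx, θ, hθ, h | h⟩ := hz
  · refine ⟨x, hx, θ, hθ, Or.inr ?_⟩
    rw [h, map_mul, conj_ofReal, ← exp_conj, map_mul, conj_ofReal, conj_I, neg_mul]
  · refine ⟨x, hx, θ, hθ, Or.inl ?_⟩
    rw [h, map_mul, conj_ofReal, ← exp_conj, map_neg, map_mul, conj_ofReal, conj_I, neg_mul,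
      neg_neg]

theorem abs_arg_le_of_mem_sector (hβ : β < 2) (hz : z ∈ sector β) (hz0 : z ≠ 0) :
    |arg z| ≤ β * Real.pi / 2 := by
  obtain ⟨x, hx, η, hη, rfl⟩ := exists_polar_of_mem_sector hz
  have hpi := Real.pi_pos
  have hx0 : 0 < x := lt_of_le_of_ne hx.1 fun h => hz0 (by simp [← h])
  have hlt : |η| < Real.pi := hη.trans_lt (by nlinarith)
  rw [exp_mul_I, arg_mul_cos_add_sin_mul_I hx0 ⟨(abs_lt.1 hlt).1, (abs_lt.1 hlt).2.le⟩]
  exact hη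

theorem mem_slitPlane_of_mem_sector (hβ : β < 2) (hz : z ∈ sector β) (hz0 : z ≠ 0) :
    z ∈ slitPlane := by
  refine mem_slitPlane_iff_arg.2 ⟨fun h => ?_, hz0⟩
  have h1 := abs_arg_le_of_mem_sector hβ hz hz0
  have hpi := Real.pi_pos
  rw [h, abs_of_pos hpi] at h1
  nlinarith

theorem re_nonneg_of_mem_sector (hβ : β ≤ 1) (hz : z ∈ sector β) : 0 ≤ z.re := by
  obtain ⟨x, hx, η, hη, rfl⟩ := exists_polar_of_mem_sector hz
  rw [re_ofReal_mul, exp_ofReal_mul_I_re]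
  have hpi := Real.pi_pos
  have h : |η| ≤ Real.pi / 2 := hη.trans (by nlinarith)
  exact mul_nonneg hx.1 (Real.cos_nonneg_of_mem_Icc ⟨(abs_le.1 h).1, (abs_le.1 h).2⟩)

theorem exists_eq_ofReal_of_mem_sector_zero (hz : z ∈ sector 0) :
    ∃ x ∈ Icc (0 : ℝ) 1, z = x := by
  obtain ⟨x, hx, η, hη, rfl⟩ := exists_polar_of_mem_sector hz
  have : η = 0 := by simpa using hη
  exact ⟨x, hx, by simp [this]⟩

theorem varkappa_pos (hβ : β < 2) : 0 < varkappa β := by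
  have hpi := Real.pi_pos
  unfold varkappa
  split_ifs with h
  · exact one_pos
  · exact Real.sin_pos_of_pos_of_lt_pi (by nlinarith [not_lt.1 h]) (by nlinarith)

theorem varkappa_le_one : varkappa β ≤ 1 := by
  unfold varkappa
  split_ifs with h
  · exact le_rfl
  · exact Real.sin_le_one _

theorem norm_ofReal_add_sq (X : ℝ) (z : ℂ) : ‖(X : ℂ) + z‖ ^ 2 = X ^ 2 + ‖z‖ ^ 2 + 2 * X * z.re := by
  rw [← normSq_eq_norm_sq, ← normSq_eq_norm_sq, normSq_apply, normSq_apply]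
  simp
  ring

theorem max_le_norm_ofReal_add {X : ℝ} (hX : 0 ≤ X) (hz : 0 ≤ z.re) :
    max X ‖z‖ ≤ ‖(X : ℂ) + z‖ := by
  have h := norm_ofReal_add_sq X z
  have h0 := mul_nonneg hX hz
  refine max_le ?_ ?_
  · exact (pow_le_pow_iff_left₀ hX (norm_nonneg _) two_ne_zero).1
      (by nlinarith [norm_nonneg z])
  · exact (pow_le_pow_iff_left₀ (norm_nonneg _) (norm_nonneg _) two_ne_zero).1
      (by nlinarith [sq_nonneg X])

/-- If re z ≥ 0 there is no cancellation. Otherwise z = x e^{iη} with π/2 < |η| ≤ βπ/2, and |X + z|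
is at least X|sin η| and x|sin η|, by completing squares. -/
theorem varkappa_mul_max_le (hβ : β < 2) (hz : z ∈ sector β) {X : ℝ} (hX : 0 ≤ X) :
    varkappa β * max X ‖z‖ ≤ ‖(X : ℂ) + z‖ := by
  have hmax : 0 ≤ max X ‖z‖ := le_max_of_le_left hX
  by_cases hre : 0 ≤ z.re
  · exact (mul_le_of_le_one_left hmax varkappa_le_one).trans (max_le_norm_ofReal_add hX hre)
  have hβ1 : ¬ β < 1 := fun h => hre (re_nonneg_of_mem_sector h.le hz)
  have hsq := norm_ofReal_add_sq X z
  obtain ⟨x, hx, η, hη, rfl⟩ := exists_polar_of_mem_sector hz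
  rw [varkappa, if_neg hβ1]
  have hpi := Real.pi_pos
  rw [re_ofReal_mul, exp_ofReal_mul_I_re] at hre hsq
  rw [norm_mul, norm_exp_ofReal_mul_I, mul_one, norm_real, Real.norm_of_nonneg hx.1] at hsq ⊢
  have hcos : Real.cos η < 0 := by
    by_contra! h
    exact hre (mul_nonneg hx.1 h)
  have hη2 : Real.pi / 2 < |η| := by
    by_contra! h
    exact absurd (Real.cos_nonneg_of_mem_Icc ⟨(abs_le.1 h).1, (abs_le.1 h).2⟩) (not_le.2 hcos)
  have hs : Real.sin (β * Real.pi / 2) ≤ Real.sin |η| := by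
    rw [← Real.sin_pi_sub, ← Real.sin_pi_sub |η|]
    refine Real.sin_le_sin_of_le_of_le_pi_div_two ?_ ?_ ?_ <;> nlinarith
  have hs0 : 0 ≤ Real.sin (β * Real.pi / 2) :=
    Real.sin_nonneg_of_nonneg_of_le_pi (by nlinarith [not_lt.1 hβ1]) (by nlinarith)
  have hs2 : Real.sin (β * Real.pi / 2) ^ 2 + Real.cos η ^ 2 ≤ 1 := by
    rw [← Real.cos_abs, ← Real.sin_sq_add_cos_sq |η|]
    gcongr
  set S := Real.sin (β * Real.pi / 2)
  rw [mul_max_of_nonneg _ _ hs0]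
  refine max_le ?_ ?_
  · refine (pow_le_pow_iff_left₀ (by positivity) (norm_nonneg _) two_ne_zero).1 ?_
    nlinarith [sq_nonneg (x + X * Real.cos η), mul_le_mul_of_nonneg_left hs2 (sq_nonneg X)]
  · refine (pow_le_pow_iff_left₀ (mul_nonneg hs0 hx.1) (norm_nonneg _) two_ne_zero).1 ?_
    nlinarith [sq_nonneg (X + x * Real.cos η), mul_le_mul_of_nonneg_left hs2 (sq_nonneg x)]

end sector

/-! ### Choice of the angle of the shifted contour. -/

section directions

/-- Replacing X by |z|, or conversely, costs |X - |z||, which is itself at most |Xu + z|. Hence both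
X|u + v| and |z||u + v| are at most 2|Xu + z|. -/
theorem mul_max_le_norm_of_direction {u v z : ℂ} (hv : ‖v‖ = 1) (hu : ‖u‖ = 1)
    (hz : z = ‖z‖ * v) (huv : 1 / 4 ≤ ‖u + v‖) {X : ℝ} (hX : 0 < X) :
    1 / 8 * max X ‖z‖ ≤ ‖X * u + z‖ := by
  set r := ‖z‖ with hr
  have hr0 : 0 ≤ r := norm_nonneg z
  have h0 : |X - r| ≤ ‖X * u + z‖ := by
    have := abs_norm_sub_norm_le ((X : ℂ) * u) (-z)
    rw [norm_neg, norm_mul, hu, norm_real, Real.norm_of_nonneg hX.le, mul_one, sub_neg_eq_add] at this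
    exact this
  have h1 : X * ‖u + v‖ ≤ ‖X * u + z‖ + |X - r| := by
    have e : (X : ℂ) * (u + v) = (X * u + z) + ((X - r : ℝ) : ℂ) * v := by
      rw [hz]; push_cast; ring
    have := norm_add_le ((X : ℂ) * u + z) (((X - r : ℝ) : ℂ) * v)
    rwa [← e, norm_mul, norm_mul, norm_real, norm_real, Real.norm_of_nonneg hX.le, hv, mul_one,
      Real.norm_eq_abs] at this
  have h2 : r * ‖u + v‖ ≤ ‖X * u + z‖ + |X - r| := by
    have e : (r : ℂ) * (u + v) = (X * u + z) + ((r - X : ℝ) : ℂ) * u := by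
      rw [hz]; push_cast; ring
    have := norm_add_le ((X : ℂ) * u + z) (((r - X : ℝ) : ℂ) * u)
    rwa [← e, norm_mul, norm_mul, norm_real, norm_real, Real.norm_of_nonneg hr0, hu, mul_one,
      Real.norm_eq_abs, abs_sub_comm] at this
  rw [mul_max_of_nonneg _ _ (by norm_num : (0 : ℝ) ≤ 1 / 8)]
  refine max_le ?_ ?_
  · nlinarith
  · nlinarith

/-- Of two well separated directions, at least one keeps away from `-z`. -/
theorem exists_direction {u₁ u₂ z : ℂ} (h₁ : ‖u₁‖ = 1) (h₂ : ‖u₂‖ = 1) (h : 1 / 2 ≤ ‖u₁ - u₂‖)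
    (hz : z ≠ 0) : (∀ X : ℝ, 0 < X → 1 / 8 * max X ‖z‖ ≤ ‖X * u₁ + z‖) ∨
      ∀ X : ℝ, 0 < X → 1 / 8 * max X ‖z‖ ≤ ‖X * u₂ + z‖ := by
  have hz' : (‖z‖ : ℂ) ≠ 0 := by simpa using hz
  set v := z / ‖z‖ with hv
  have hv1 : ‖v‖ = 1 := by
    rw [hv, norm_div, norm_real, norm_norm, div_self (norm_ne_zero_iff.2 hz)]
  have hzv : z = ‖z‖ * v := by rw [hv]; field_simp
  by_cases hc : 1 / 4 ≤ ‖u₁ + v‖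
  · exact Or.inl fun X hX => mul_max_le_norm_of_direction hv1 h₁ hzv hc hX
  · refine Or.inr fun X hX => mul_max_le_norm_of_direction hv1 h₂ hzv ?_ hX
    have := norm_sub_le (u₁ + v) (u₂ + v)
    rw [add_sub_add_right_eq_sub] at this
    linarith

/-- When cos φ = -√2/2, 2|Xe^{iφ} + s|² = X² + (√2 s - X)², and symmetrically. This is the √2 in the
numerator of 𝒢. -/
theorem max_le_sqrt_two_mul_norm {φ X s : ℝ} (hX : 0 < X) (hs : 0 < s)
    (hφ : -(√2 / 2) ≤ Real.cos φ) : max X s ≤ √2 * ‖X * cexp (φ * I) + s‖ := by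
  have h2 : √2 ^ 2 = 2 := Real.sq_sqrt (by norm_num)
  have hq := Real.sqrt_nonneg 2
  have h : ‖X * cexp (φ * I) + s‖ ^ 2 = s ^ 2 + X ^ 2 + 2 * s * (X * Real.cos φ) := by
    rw [add_comm, norm_ofReal_add_sq, norm_mul, norm_exp_ofReal_mul_I, mul_one, norm_real,
      Real.norm_of_nonneg hX.le, re_ofReal_mul, exp_ofReal_mul_I_re]
  have hX' := mul_le_mul_of_nonneg_left hφ (mul_pos hs hX).le
  refine max_le ?_ ?_
  · refine (pow_le_pow_iff_left₀ hX.le (by positivity) two_ne_zero).1 ?_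
    rw [mul_pow, h2, h]
    nlinarith [sq_nonneg (√2 * s - X)]
  · refine (pow_le_pow_iff_left₀ hs.le (by positivity) two_ne_zero).1 ?_
    rw [mul_pow, h2, h]
    nlinarith [sq_nonneg (√2 * X - s)]

theorem half_le_norm_exp_sub_exp {φ ψ : ℝ} (hφ : Real.cos φ = -(√2 / 2)) (hψ : Real.cos ψ = 0) :
    1 / 2 ≤ ‖cexp (ψ * I) - cexp (φ * I)‖ := by
  have h1 : Real.cos ψ - Real.cos φ ≤ ‖cexp (ψ * I) - cexp (φ * I)‖ := by
    refine le_trans (le_of_eq ?_) (re_le_norm _)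
    rw [sub_re, exp_ofReal_mul_I_re, exp_ofReal_mul_I_re]
  have : (1 : ℝ) ≤ √2 := by rw [Real.le_sqrt] <;> norm_num
  rw [hφ, hψ] at h1
  linarith

theorem cos_three_pi_div_four : Real.cos (3 * Real.pi / 4) = -(√2 / 2) := by
  rw [show 3 * Real.pi / 4 = Real.pi - Real.pi / 4 by ring, Real.cos_pi_sub, Real.cos_pi_div_four]

theorem cos_five_pi_div_four : Real.cos (5 * Real.pi / 4) = -(√2 / 2) := by
  rw [show 5 * Real.pi / 4 = Real.pi / 4 + Real.pi by ring, Real.cos_add_pi, Real.cos_pi_div_four]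

theorem cos_three_pi_div_two : Real.cos (3 * Real.pi / 2) = 0 := by
  rw [show 3 * Real.pi / 2 = Real.pi / 2 + Real.pi by ring, Real.cos_add_pi, Real.cos_pi_div_two,
    neg_zero]

/-- The height of the shifted line. -/
theorem exists_contour_angle (β : ℝ) (hβ0 : 0 ≤ β) {z : ℂ} (hz : z ≠ 0) :
    ∃ φ : ℝ, (2 - β) * Real.pi / 2 ≤ φ ∧ φ ≤ 5 ∧ -(√2 / 2) ≤ Real.cos φ ∧
      (1 ≤ β → φ < Real.pi) ∧ ∀ X : ℝ, 0 < X → 1 / 8 * max X ‖z‖ ≤ ‖X * cexp (φ * I) + z‖ := by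
  have hpi := Real.pi_pos
  have hpi2 := Real.pi_lt_d2
  have hq := Real.sqrt_nonneg 2
  -- The bound φ ≥ (2 - β)π/2 allows π/2 once β ≥ 1. For β < 1 the bound can come up to π, where the
  -- node factors may vanish; the contour must pass beyond π, to an angle with cos φ ≥ -√2/2.
  rcases le_or_gt 1 β with hβ | hβ
  · have hsep := half_le_norm_exp_sub_exp cos_three_pi_div_four Real.cos_pi_div_two
    rcases exists_direction (norm_exp_ofReal_mul_I _) (norm_exp_ofReal_mul_I _) hsep hz with h | h
    · refine ⟨Real.pi / 2, by nlinarith, by linarith, ?_, fun _ => by linarith, h⟩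
      rw [Real.cos_pi_div_two]
      linarith
    · exact ⟨3 * Real.pi / 4, by nlinarith, by linarith, cos_three_pi_div_four.ge,
        fun _ => by linarith, h⟩
  · have hsep := half_le_norm_exp_sub_exp cos_five_pi_div_four cos_three_pi_div_two
    rcases exists_direction (norm_exp_ofReal_mul_I _) (norm_exp_ofReal_mul_I _) hsep hz with h | h
    · refine ⟨3 * Real.pi / 2, by nlinarith, by linarith, ?_, fun h => by linarith, h⟩
      rw [cos_three_pi_div_two]
      linarith
    · exact ⟨5 * Real.pi / 4, by nlinarith, by linarith, cos_five_pi_div_four.ge,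
        fun h => by linarith, h⟩

end directions

/-! ### The exponential rate 𝒢. -/

section growth

theorem sqrt_two_sq : √2 * √2 = 2 := Real.mul_self_sqrt (by norm_num)

theorem lt_sqrt_two : 1.4142 < √2 := by
  rw [Real.lt_sqrt] <;> norm_num

theorem sqrt_two_lt : √2 < 1.4143 := by
  rw [Real.sqrt_lt'] <;> norm_num

theorem growthBase_zero : growthBase 0 = 2 + √2 := by
  have h1 := lt_sqrt_two
  rw [growthBase, if_pos rfl, div_eq_iff (by linarith)]
  nlinarith [sqrt_two_sq]

theorem growthBase_of_ne_zero {β : ℝ} (hβ : β ≠ 0) : growthBase β = 4 + 3 * √2 := by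
  have h1 := lt_sqrt_two
  rw [growthBase, if_neg hβ, div_eq_iff (by linarith)]
  nlinarith [sqrt_two_sq]

theorem two_le_growthBase (β : ℝ) : 2 ≤ growthBase β := by
  have h1 := lt_sqrt_two
  rcases eq_or_ne β 0 with rfl | h
  · rw [growthBase_zero]; linarith
  · rw [growthBase_of_ne_zero h]; linarith

theorem growthBase_le (β : ℝ) : growthBase β ≤ 9 := by
  have h1 := sqrt_two_lt
  rcases eq_or_ne β 0 with rfl | h
  · rw [growthBase_zero]; linarith
  · rw [growthBase_of_ne_zero h]; linarith

theorem pow_le_mul_rpow {G α : ℝ} {ell : ℕ} (hG : 1 ≤ G) (hl' : ell ≤ α + 1) :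
    G ^ ell ≤ G * G ^ α := by
  rw [← Real.rpow_natCast]
  calc G ^ (ell : ℝ) ≤ G ^ (α + 1) := Real.rpow_le_rpow_of_exponent_le hG hl'
    _ = G * G ^ α := by rw [Real.rpow_add (by linarith), Real.rpow_one, mul_comm]

theorem growthBase_pow_le {β α : ℝ} {ell : ℕ} (hl' : ell ≤ α + 1) :
    growthBase β ^ ell ≤ 9 * growthBase β ^ α := by
  have h2 := two_le_growthBase β
  refine (pow_le_mul_rpow (by linarith) hl').trans ?_
  have := growthBase_le β
  have : 0 ≤ growthBase β ^ α := by positivity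
  gcongr

theorem prod_Icc_le_pow {f : ℕ → ℝ} {G : ℝ} (ell : ℕ) (h0 : ∀ k, 0 ≤ f k) (h : ∀ k, f k ≤ G) :
    ∏ k ∈ Finset.Icc 1 ell, f k ≤ G ^ ell := by
  refine (Finset.prod_le_prod (fun k _ => h0 k) fun k _ => h k).trans_eq ?_
  simp

theorem norm_sub_node_le {z : ℂ} (hz : ‖z‖ ≤ 1) (ell k : ℕ) :
    ‖z - node ell k‖ ≤ 1 + node ell k := by
  refine (norm_sub_le _ _).trans ?_
  rw [norm_node]
  linarith

theorem norm_ofReal_sub_node (x : ℝ) (ell k : ℕ) :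
    ‖(x : ℂ) - node ell k‖ = |x - node ell k| := by
  rw [← ofReal_sub, norm_real, Real.norm_eq_abs]

theorem prod_sqrt_two_mul_le {β α : ℝ} {ell : ℕ} {z : ℂ} (hl' : ell ≤ α + 1)
    (hz : z ∈ sector β) :
    ∏ k ∈ Finset.Icc 1 ell, √2 * ‖z - node ell k‖ ≤ 9 * growthBase β ^ α := by
  have h1 := lt_sqrt_two
  have h2 := sqrt_two_lt
  refine le_trans ?_ (growthBase_pow_le hl')
  refine prod_Icc_le_pow ell (fun k => ?_) fun k => ?_
  · have := node_pos ell k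
    positivity
  have hn := node_le ell k
  have hp := node_pos ell k
  rcases eq_or_ne β 0 with rfl | h
  · obtain ⟨x, hx, rfl⟩ := exists_eq_ofReal_of_mem_sector_zero hz
    rw [growthBase_zero, norm_ofReal_sub_node]
    have : |x - node ell k| ≤ 2 := by
      rw [abs_le]
      constructor <;> linarith [hx.1, hx.2]
    nlinarith
  · rw [growthBase_of_ne_zero h]
    have := norm_sub_node_le (norm_le_one_of_mem_sector hz) ell k
    nlinarith

/-- For β = 0 the pairing of nodes bounds the product by √2^ℓ. For β ≠ 0 each factor is at most √2(1
+ 1/δ), which is exactly 𝒢. The 9 pays for replacing ℓ by α. -/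
theorem prod_sqrt_two_mul_div_le {β α : ℝ} {ell : ℕ} {z : ℂ} (hl' : ell ≤ α + 1)
    (hz : z ∈ sector β) :
    ∏ k ∈ Finset.Icc 1 ell, √2 * ‖z - node ell k‖ / node ell k ≤ 9 * growthBase β ^ α := by
  have h1 := lt_sqrt_two
  have h2 := sqrt_two_lt
  refine le_trans ?_ (growthBase_pow_le hl')
  rcases eq_or_ne β 0 with rfl | h
  · obtain ⟨x, hx, rfl⟩ := exists_eq_ofReal_of_mem_sector_zero hz
    simp only [growthBase_zero, norm_ofReal_sub_node]
    rw [Finset.prod_div_distrib, Finset.prod_mul_distrib, Finset.prod_const, Nat.card_Icc,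
      Nat.add_sub_cancel, div_le_iff₀ (Finset.prod_pos fun k _ => node_pos ell k)]
    have := prod_abs_sub_node_le (Finset.Subset.refl _) Icc_reflect_mem hx.1 hx.2 (ell := ell)
    gcongr
    linarith
  · refine prod_Icc_le_pow ell (fun k => ?_) fun k => ?_
    · have := node_pos ell k
      positivity
    have hd := delta_le_node ell k
    rw [growthBase_of_ne_zero h, div_le_iff₀ (node_pos ell k)]
    have := norm_sub_node_le (norm_le_one_of_mem_sector hz) ell k
    unfold delta at hd
    nlinarith [sqrt_two_sq]

end growth

end

/-! ### Residue bounds and decay of the Fourier integrals. -/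

section

open Filter Topology MeasureTheory Complex Set

theorem norm_entireFactor_pole {C α : ℝ} {ell l : ℕ} {z s : ℂ} (hC : 0 < C) (hα : 0 < α)
    (hs : s ≠ 0) : ‖entireFactor C α ell l z (pole C α s)‖ =
      ‖z‖ * (∏ k ∈ Finset.Icc 1 ell, ‖z - node ell k‖) * (‖s‖ ^ α * ‖pole C α s‖ ^ l) := by
  have h1 : 0 ≤ C ^ α := Real.rpow_nonneg hC.le _
  have h2 : ‖s‖ = C * Real.exp ((pole C α s).re / α) := by
    rw [← norm_const_mul_cexp_div hC, const_mul_cexp_pole hC hα hs, norm_neg]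
  have h3 : ‖s‖ ^ α = C ^ α * Real.exp (pole C α s).re := by
    rw [h2, Real.mul_rpow hC.le (Real.exp_pos _).le, ← Real.exp_mul, div_mul_cancel₀ _ hα.ne']
  rw [h3]
  simp only [entireFactor, norm_mul, norm_prod, norm_pow, norm_real, Real.norm_of_nonneg h1,
    norm_exp]
  ring

/-- The interpolation factors ∏ (z - s_k) cancel against the denominators evaluated at the pole, so
no exponential growth in ℓ is left. -/
theorem residueNorm_self {C α : ℝ} {ell l : ℕ} {z : ℂ} (hC : 0 < C) (hα : 0 < α) (hz0 : z ≠ 0)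
    (hzn : ∀ k ∈ Finset.Icc 1 ell, z ≠ node ell k) :
    residueNorm C α ell l z z = α * ‖pole C α z‖ ^ l * ‖z‖ ^ α := by
  have hmem : z ∉ (Finset.Icc 1 ell).image fun k => (node ell k : ℂ) := by
    simp only [Finset.mem_image, not_exists, not_and]
    exact fun k hk h => hzn k hk h.symm
  have hprod : (∏ k ∈ Finset.Icc 1 ell, ‖z - node ell k‖) *
      ∏ k ∈ Finset.Icc 1 ell, ‖(node ell k : ℂ) - z‖⁻¹ = 1 := by
    rw [← Finset.prod_mul_distrib]
    refine Finset.prod_eq_one fun k hk => ?_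
    rw [norm_sub_rev, mul_inv_cancel₀]
    exact norm_ne_zero_iff.2 (sub_ne_zero.2 (hzn k hk).symm)
  have hn : ‖z‖ ≠ 0 := norm_ne_zero_iff.2 hz0
  rw [residueNorm, norm_entireFactor_pole hC hα hz0, singSet, Finset.erase_insert hmem,
    Finset.prod_image (nodeC_injOn ell)]
  calc _ = ((∏ k ∈ Finset.Icc 1 ell, ‖z - node ell k‖) *
        ∏ k ∈ Finset.Icc 1 ell, ‖(node ell k : ℂ) - z‖⁻¹) * (‖z‖ * ‖z‖⁻¹) *
          (α * ‖pole C α z‖ ^ l * ‖z‖ ^ α) := by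
        rw [div_eq_mul_inv]
        ring
    _ = _ := by rw [hprod, mul_inv_cancel₀ hn, one_mul, one_mul]

theorem residue_factors_le {α d s n w R Q u b p D F : ℝ} (hα : 0 < α) (hd : 0 < d) (hds : d ≤ s)
    (hn0 : 0 ≤ n) (hn : n ≤ 1) (hw : w ≠ 0) (hR : 0 ≤ R) (hRQ : R ≤ Q) (hu : 0 ≤ u) (hub : u ≤ b)
    (hp : 0 ≤ p) (hD : 0 < D) (hF : D⁻¹ ≤ F) :
    n * (w * R) * (u * p) * (α / s * (w⁻¹ * D⁻¹)) ≤ α / d * (b * p) * (Q * F) := by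
  have hs : 0 < s := hd.trans_le hds
  have hQ : 0 ≤ Q := hR.trans hRQ
  have hb : 0 ≤ b := hu.trans hub
  have f1 : α / s ≤ α / d := div_le_div_of_nonneg_left hα.le hd hds
  have f2 : n * (u * p) ≤ 1 * (b * p) :=
    mul_le_mul hn (mul_le_mul_of_nonneg_right hub hp) (mul_nonneg hu hp) zero_le_one
  have f3 : R * D⁻¹ ≤ Q * F := mul_le_mul hRQ hF (inv_nonneg.2 hD.le) hQ
  calc _ = α / s * (n * (u * p)) * (R * D⁻¹) * (w * w⁻¹) := by ring
    _ = α / s * (n * (u * p)) * (R * D⁻¹) := by rw [mul_inv_cancel₀ hw, mul_one]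
    _ ≤ α / d * (1 * (b * p)) * (Q * F) :=
        mul_le_mul (mul_le_mul f1 f2 (by positivity) (by positivity)) f3 (by positivity)
          (by positivity)
    _ = _ := by ring

/-- The denominator z - s_k cancels the k-th numerator, so a node close to z does no harm. The
remaining node differences are bounded below by `prod_erase_abs_node_sub`. -/
theorem residueNorm_node_le {C α Q : ℝ} {ell l k : ℕ} {z : ℂ} (hC : 0 < C) (hα : 0 < α)
    (hz1 : ‖z‖ ≤ 1) (hzn : ∀ k ∈ Finset.Icc 1 ell, z ≠ node ell k) (hk : k ∈ Finset.Icc 1 ell)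
    (hQ : ∏ j ∈ (Finset.Icc 1 ell).erase k, ‖z - node ell j‖ ≤ Q) :
    residueNorm C α ell l z (node ell k) ≤
      α / delta * (((√2 + 1) / 2) ^ α * ‖pole C α (node ell k)‖ ^ l) *
        (Q * (4 ^ ell / (4 * ell))) := by
  have hs0 : (node ell k : ℂ) ≠ 0 := by exact_mod_cast (node_pos ell k).ne'
  have hm := Finset.mem_Icc.1 hk
  have hell : (0 : ℝ) < ell := by
    have : 0 < ell := by omega
    exact_mod_cast this
  have herase : (singSet ell z).erase (node ell k) =
      insert z (((Finset.Icc 1 ell).erase k).image fun k => (node ell k : ℂ)) := by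
    rw [singSet, Finset.erase_insert_of_ne (hzn k hk)]
    congr 1
    ext w
    simp only [Finset.mem_erase, Finset.mem_image]
    constructor
    · rintro ⟨h1, j, hj, rfl⟩
      exact ⟨j, ⟨fun h => h1 (by rw [h]), hj⟩, rfl⟩
    · rintro ⟨j, ⟨h1, hj⟩, rfl⟩
      exact ⟨fun h => h1 (nodeC_injOn ell hj hk h), j, hj, rfl⟩
  have hnot : z ∉ ((Finset.Icc 1 ell).erase k).image fun k => (node ell k : ℂ) := by
    simp only [Finset.mem_image, Finset.mem_erase, not_exists, not_and]
    exact fun j hj h => hzn j hj.2 h.symm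
  have hprod := prod_erase_abs_node_sub hk
  set D := ∏ j ∈ (Finset.Icc 1 ell).erase k, |node ell j - node ell k| with hD
  have hDpos : 0 < D := by
    have : 0 < 4 ^ ell * D := lt_of_lt_of_le (by positivity) hprod
    exact pos_of_mul_pos_right this (by positivity)
  have hinv : ∏ j ∈ (Finset.Icc 1 ell).erase k, ‖(node ell j : ℂ) - node ell k‖⁻¹ = D⁻¹ := by
    rw [hD, ← Finset.prod_inv_distrib]
    refine Finset.prod_congr rfl fun j _ => ?_
    rw [norm_ofReal_sub_node]
  have hz : ‖z - node ell k‖ ≠ 0 := norm_ne_zero_iff.2 (sub_ne_zero.2 (hzn k hk))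
  have hQ0 : 0 ≤ Q := le_trans (Finset.prod_nonneg fun _ _ => norm_nonneg _) hQ
  rw [residueNorm, norm_entireFactor_pole hC hα hs0, herase, Finset.prod_insert hnot,
    Finset.prod_image ((nodeC_injOn ell).mono (Finset.coe_subset.2 (Finset.erase_subset _ _))),
    hinv, ← Finset.mul_prod_erase _ _ hk, norm_node]
  have hDinv : D⁻¹ ≤ 4 ^ ell / (4 * ell) := by
    rw [inv_eq_one_div, div_le_div_iff₀ hDpos (by positivity)]
    linarith
  set R := ∏ j ∈ (Finset.Icc 1 ell).erase k, ‖z - node ell j‖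
  have hR0 : 0 ≤ R := Finset.prod_nonneg fun _ _ => norm_nonneg _
  have hpow : node ell k ^ α ≤ ((√2 + 1) / 2) ^ α :=
    Real.rpow_le_rpow (node_pos ell k).le (node_le ell k) hα.le
  have hnp := node_pos ell k
  exact residue_factors_le hα delta_pos (delta_le_node ell k) (norm_nonneg z) hz1 hz hR0 hQ
    (Real.rpow_nonneg hnp.le α) hpow (pow_nonneg (norm_nonneg _) l) hDpos hDinv

theorem norm_pole_le {C α : ℝ} (hα : 0 < α) (s : ℂ) :
    ‖pole C α s‖ ≤ α * (|Real.log ‖s‖| + |Real.log C| + 7) := by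
  refine (norm_le_abs_re_add_abs_im _).trans ?_
  rw [pole_re, pole_im, abs_mul, abs_mul, abs_of_pos hα, ← mul_add]
  refine mul_le_mul_of_nonneg_left ?_ hα.le
  have h1 := abs_sub (Real.log ‖s‖) (Real.log C)
  have h2 := abs_add_le (arg s) Real.pi
  have h3 := abs_arg_le_pi s
  have h4 := Real.pi_lt_d2
  rw [abs_of_pos Real.pi_pos] at h2
  linarith

theorem abs_log_node_le (ell k : ℕ) : |Real.log (node ell k)| ≤ 4 := by
  have hp := node_pos ell k
  have h1 := Real.log_le_sub_one_of_pos hp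
  have h2 := Real.log_le_sub_one_of_pos (inv_pos.2 hp)
  rw [Real.log_inv] at h2
  have h3 : (node ell k)⁻¹ ≤ 5 := by
    rw [inv_le_comm₀ hp (by norm_num)]
    refine le_trans ?_ (delta_le_node ell k)
    have := lt_sqrt_two
    unfold delta
    linarith
  have h4 := node_le ell k
  have h5 := sqrt_two_lt
  rw [abs_le]
  constructor <;> linarith

theorem pow_le_of_le {r B : ℝ} {l : ℕ} (hl : l = 0 ∨ l = 1) (hr : r ≤ B) (hB : 1 ≤ B) :
    r ^ l ≤ B := by
  rcases hl with rfl | rfl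
  · simpa using hB
  · simpa using hr

/-- The pole contains α log|z|, unbounded as z → 0, but |z|^α compensates: v e^{-v} ≤ 1 with v = -α
log|z|. -/
theorem residueNorm_self_le {C α : ℝ} {ell l : ℕ} {z : ℂ} (hC : 0 < C) (hα : 0 < α)
    (hl01 : l = 0 ∨ l = 1) (hz0 : z ≠ 0) (hz1 : ‖z‖ ≤ 1)
    (hzn : ∀ k ∈ Finset.Icc 1 ell, z ≠ node ell k) :
    residueNorm C α ell l z z ≤ (|Real.log C| + 11) * (1 + α) ^ 2 := by
  rw [residueNorm_self hC hα hz0 hzn]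
  have hn : 0 < ‖z‖ := norm_pos_iff.2 hz0
  have hpow : ‖z‖ ^ α ≤ 1 := Real.rpow_le_one hn.le hz1 hα.le
  have hlog : Real.log ‖z‖ ≤ 0 := Real.log_nonpos hn.le hz1
  have hL := abs_nonneg (Real.log C)
  have hp0 : 0 ≤ ‖z‖ ^ α := by positivity
  rcases hl01 with rfl | rfl
  · rw [pow_zero, mul_one]
    nlinarith
  · rw [pow_one]
    have h1 : α * |Real.log ‖z‖| * ‖z‖ ^ α ≤ 1 := by
      rw [Real.rpow_def_of_pos hn, abs_of_nonpos hlog]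
      have h2 := Real.add_one_le_exp (-(Real.log ‖z‖ * α))
      have h3 : Real.exp (-(Real.log ‖z‖ * α)) * Real.exp (Real.log ‖z‖ * α) = 1 := by
        rw [← Real.exp_add, neg_add_cancel, Real.exp_zero]
      have h4 := Real.exp_pos (Real.log ‖z‖ * α)
      nlinarith
    calc α * ‖pole C α z‖ * ‖z‖ ^ α ≤
        α * (α * (|Real.log ‖z‖| + |Real.log C| + 7)) * ‖z‖ ^ α := by
          gcongr
          exact norm_pole_le hα z
      _ = α * (α * |Real.log ‖z‖| * ‖z‖ ^ α) + α ^ 2 * (|Real.log C| + 7) * ‖z‖ ^ α := by ring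
      _ ≤ α * 1 + α ^ 2 * (|Real.log C| + 7) * 1 := by gcongr
      _ ≤ _ := by nlinarith

/-- The ℓ terms are paid for by the 1/ℓ in each of them, inherited from T_ℓ' = ℓ U_{ℓ-1}. -/
theorem sum_residueNorm_node_le {C α Q : ℝ} {ell l : ℕ} {z : ℂ} (hC : 0 < C) (hα : 0 < α)
    (hl01 : l = 0 ∨ l = 1) (hz1 : ‖z‖ ≤ 1) (hzn : ∀ k ∈ Finset.Icc 1 ell, z ≠ node ell k)
    (hQ0 : 0 ≤ Q)
    (hQ : ∀ k ∈ Finset.Icc 1 ell, ∏ j ∈ (Finset.Icc 1 ell).erase k, ‖z - node ell j‖ ≤ Q) :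
    ∑ k ∈ Finset.Icc 1 ell, residueNorm C α ell l z (node ell k) ≤
      (|Real.log C| + 11) / delta * ((1 + α) ^ 2 * ((√2 + 1) / 2) ^ α) * (Q * 4 ^ ell) := by
  have hL := abs_nonneg (Real.log C)
  have hd := delta_pos
  rcases Nat.eq_zero_or_pos ell with rfl | hell
  · simp only [Finset.Icc_eq_empty_of_lt zero_lt_one, Finset.sum_empty]
    positivity
  have hell' : (0 : ℝ) < ell := by exact_mod_cast hell
  have hterm : ∀ k ∈ Finset.Icc 1 ell, residueNorm C α ell l z (node ell k) ≤
      α / delta * (((√2 + 1) / 2) ^ α * ((|Real.log C| + 11) * (1 + α))) *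
        (Q * (4 ^ ell / (4 * ell))) := by
    intro k hk
    refine (residueNorm_node_le hC hα hz1 hzn hk (hQ k hk)).trans ?_
    gcongr
    refine pow_le_of_le hl01 ((norm_pole_le hα _).trans ?_) (by nlinarith)
    rw [norm_node]
    have := abs_log_node_le ell k
    nlinarith
  refine (Finset.sum_le_card_nsmul _ _ _ hterm).trans ?_
  rw [Nat.card_Icc, Nat.add_sub_cancel, nsmul_eq_mul]
  have hpw : 0 ≤ ((√2 + 1) / 2) ^ α := by positivity
  calc _ = (|Real.log C| + 11) / delta * ((α / 4) * (1 + α) * ((√2 + 1) / 2) ^ α) * (Q * 4 ^ ell) := by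
        field_simp
    _ ≤ _ := by
        gcongr
        nlinarith

/-- Polynomial factors are absorbed by a small change of the base. -/
theorem exists_one_add_sq_le : ∃ K : ℝ, 0 < K ∧ ∀ α : ℝ, 0 < α →
    (1 + α) ^ 2 ≤ K * (27 / 25 : ℝ) ^ α := by
  set η := Real.log (27 / 25) with hη
  have hη0 : 0 < η := Real.log_pos (by norm_num)
  have hη1 : η ≤ 1 := (Real.log_le_sub_one_of_pos (by norm_num)).trans (by norm_num)
  refine ⟨4 / η ^ 2, by positivity, fun α hα => ?_⟩
  rw [Real.rpow_def_of_pos (by norm_num), ← hη]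
  have h1 := Real.add_one_le_exp (η * α / 2)
  have h2 : Real.exp (η * α) = Real.exp (η * α / 2) ^ 2 := by
    rw [← Real.exp_nat_mul]; congr 1; push_cast; ring
  rw [h2, div_mul_eq_mul_div, le_div_iff₀ (by positivity)]
  have h3 : η * (1 + α) ≤ 2 * Real.exp (η * α / 2) := by nlinarith
  have h4 : 0 ≤ η * (1 + α) := by positivity
  nlinarith [pow_le_pow_left₀ h4 h3 2]

/-- In the right half disc |z - s|² ≤ 1 + s², which improves the bound 1 + s; the latter would
exceed the rate 𝒢. -/
theorem prod_erase_norm_sub_node_le_of_re_nonneg {z : ℂ} (hz1 : ‖z‖ ≤ 1) (hre : 0 ≤ z.re)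
    (ell k : ℕ) : ∏ j ∈ (Finset.Icc 1 ell).erase k, ‖z - node ell j‖ ≤ (63 / 40) ^ ell := by
  have hb : ∀ j, ‖z - node ell j‖ ≤ 63 / 40 := by
    intro j
    have h := norm_ofReal_add_sq (-(node ell j)) z
    rw [ofReal_neg, neg_add_eq_sub] at h
    have h1 := node_pos ell j
    have h2 := node_le ell j
    have h3 := sqrt_two_lt
    have h4 : node ell j ≤ 1.20715 := by linarith
    refine (pow_le_pow_iff_left₀ (norm_nonneg _) (by norm_num) two_ne_zero).1 ?_
    nlinarith [mul_nonneg h1.le hre, norm_nonneg z]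
  calc _ ≤ ∏ j ∈ (Finset.Icc 1 ell).erase k, (63 / 40 : ℝ) :=
        Finset.prod_le_prod (fun _ _ => norm_nonneg _) fun j _ => hb j
    _ ≤ _ := by
        rw [Finset.prod_const]
        refine pow_le_pow_right₀ (by norm_num) ((Finset.card_erase_le).trans (by simp))

theorem rpow_mul_pow_le {α ρ G : ℝ} {ell : ℕ} (hα : 0 < α) (hl' : ell ≤ α + 1) (hρ : 1 ≤ ρ)
    (hρ7 : ρ ≤ 7) (hG : 27 / 25 * ((√2 + 1) / 2) * ρ ≤ G) :
    (27 / 25 : ℝ) ^ α * ((√2 + 1) / 2) ^ α * ρ ^ ell ≤ 7 * G ^ α := by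
  have h0 : 0 ≤ (27 / 25 : ℝ) * ((√2 + 1) / 2) := by positivity
  have hb : (0 : ℝ) ≤ (27 / 25 * ((√2 + 1) / 2)) ^ α := by positivity
  have hρα : 0 ≤ ρ ^ α := by positivity
  rw [← Real.mul_rpow (by norm_num) (by positivity)]
  calc _ ≤ (27 / 25 * ((√2 + 1) / 2)) ^ α * (7 * ρ ^ α) := by
        refine mul_le_mul_of_nonneg_left ((pow_le_mul_rpow hρ hl').trans ?_) hb
        gcongr
    _ = 7 * (27 / 25 * ((√2 + 1) / 2) * ρ) ^ α := by
        rw [Real.mul_rpow h0 (by linarith)]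
        ring
    _ ≤ _ := by
        have h1 : 0 ≤ 27 / 25 * ((√2 + 1) / 2) * ρ := by positivity
        gcongr

theorem exists_sum_residueNorm_node_le {C : ℝ} (hC : 0 < C) : ∃ K : ℝ, 0 < K ∧
    ∀ β : ℝ, β < 1 → ∀ α : ℝ, 0 < α → ∀ ell : ℕ, ell ≤ α + 1 →
    ∀ l : ℕ, (l = 0 ∨ l = 1) → ∀ z ∈ sector β, (∀ k ∈ Finset.Icc 1 ell, z ≠ node ell k) →
      ∑ k ∈ Finset.Icc 1 ell, residueNorm C α ell l z (node ell k) ≤ K * growthBase β ^ α := by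
  obtain ⟨K₀, hK₀, hK⟩ := exists_one_add_sq_le
  have hd := delta_pos
  have hL := abs_nonneg (Real.log C)
  have hs1 := lt_sqrt_two
  have hs2 := sqrt_two_lt
  have hd1 : delta ≤ 1 := by unfold delta; linarith
  refine ⟨(|Real.log C| + 11) / delta * K₀ * (4 / delta ^ 2) * 7, by positivity, ?_⟩
  intro β hβ α hα ell hl' l hl01 z hz hzn
  have hz1 := norm_le_one_of_mem_sector hz
  have h4d : 1 ≤ 4 / delta ^ 2 := by
    rw [le_div_iff₀ (by positivity)]
    nlinarith
  -- Here ρ collects the rate of the product over nodes and the 4^ℓ, (√2 + 1)/2 bounds the nodes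
  -- raised to α, and 27/25 absorbs (1 + α)². The choice ρ = 63/10 below leaves very little room
  -- under 4 + 3√2, which dictates 27/25.
  have main : ∀ ρ : ℝ, 1 ≤ ρ → ρ ≤ 7 → 27 / 25 * ((√2 + 1) / 2) * ρ ≤ growthBase β →
      (∀ k ∈ Finset.Icc 1 ell, ∏ j ∈ (Finset.Icc 1 ell).erase k, ‖z - node ell j‖ ≤
        4 / delta ^ 2 * (ρ / 4) ^ ell) →
      ∑ k ∈ Finset.Icc 1 ell, residueNorm C α ell l z (node ell k) ≤
        (|Real.log C| + 11) / delta * K₀ * (4 / delta ^ 2) * 7 * growthBase β ^ α := by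
    intro ρ hρ hρ7 hG hQ
    refine (sum_residueNorm_node_le hC hα hl01 hz1 hzn (by positivity) hQ).trans ?_
    have e : 4 / delta ^ 2 * (ρ / 4) ^ ell * 4 ^ ell = 4 / delta ^ 2 * ρ ^ ell := by
      rw [mul_assoc, ← mul_pow, div_mul_cancel₀ _ (by norm_num)]
    rw [e]
    have hpw : 0 ≤ ((√2 + 1) / 2) ^ α := by positivity
    calc _ ≤ (|Real.log C| + 11) / delta * (K₀ * (27 / 25) ^ α * ((√2 + 1) / 2) ^ α) *
          (4 / delta ^ 2 * ρ ^ ell) := by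
          gcongr
          exact hK α hα
      _ = (|Real.log C| + 11) / delta * K₀ * (4 / delta ^ 2) *
          ((27 / 25) ^ α * ((√2 + 1) / 2) ^ α * ρ ^ ell) := by ring
      _ ≤ (|Real.log C| + 11) / delta * K₀ * (4 / delta ^ 2) * (7 * growthBase β ^ α) := by
          exact mul_le_mul_of_nonneg_left (rpow_mul_pow_le hα hl' hρ hρ7 hG) (by positivity)
      _ = _ := by ring
  rcases eq_or_ne β 0 with rfl | hβ0
  · obtain ⟨x, hx, rfl⟩ := exists_eq_ofReal_of_mem_sector_zero hz
    refine main (1 + √2) (by linarith) (by linarith) ?_ fun k hk => ?_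
    · rw [growthBase_zero]
      nlinarith [sqrt_two_sq]
    · simp only [norm_ofReal_sub_node]
      refine (prod_erase_abs_sub_node_le hk hx.1 hx.2).trans ?_
      calc _ ≤ 2 / delta ^ 2 * (2 * ((1 + √2) / 4) ^ ell) := by
            gcongr
            exact prod_node_le ell
        _ = _ := by ring
  · refine main (63 / 10) (by norm_num) (by norm_num) ?_ fun k hk => ?_
    · rw [growthBase_of_ne_zero hβ0]
      linarith
    · refine (prod_erase_norm_sub_node_le_of_re_nonneg hz1
        (re_nonneg_of_mem_sector hβ.le hz) ell k).trans ?_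
      rw [show (63 / 10 / 4 : ℝ) = 63 / 40 by norm_num]
      exact le_mul_of_one_le_left (by positivity) h4d

theorem growthBase_rpow_ge {β α : ℝ} (hα : 0 < α) : (27 / 25 : ℝ) ^ α ≤ growthBase β ^ α := by
  have := two_le_growthBase β
  exact Real.rpow_le_rpow (by norm_num) (by linarith) hα.le

theorem one_le_growthBase_rpow {β α : ℝ} (hα : 0 < α) : 1 ≤ growthBase β ^ α :=
  Real.one_le_rpow (by linarith [two_le_growthBase β]) hα.le

/-- The integrand satisfies the pointwise bound on the real line, with the loss `ϰ`. -/
theorem norm_cIntegrand_ofReal_le {C α β : ℝ} {ell l : ℕ} {z : ℂ} (hC : 0 < C)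
    (hα : 0 < α) (hl : α < ell + 1) (hl' : ell ≤ α + 1) (hl01 : l = 0 ∨ l = 1)
    (hβ : β < 2) (hz : z ∈ sector β) (x : ℝ) :
    ‖cIntegrand C α ell l z x‖ ≤ 9 * growthBase β ^ α / varkappa β * scaleFactor C α *
      (|x| ^ l * Real.exp x) ∧
    ‖cIntegrand C α ell l z x‖ ≤ 9 * growthBase β ^ α / varkappa β * scaleFactor C α *
      (|x| ^ l * Real.exp (-x / kappa α ell)) ∧
    ‖cIntegrand C α ell l z x‖ ≤ 9 * growthBase β ^ α / varkappa β * scaleFactor C α *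
      envelope (kappa α ell) l x := by
  have hκ := varkappa_pos hβ
  have e : (C : ℂ) * cexp ((x : ℂ) / α) = ((C * Real.exp (x / α) : ℝ) : ℂ) := by push_cast; rfl
  have hX : 0 < C * Real.exp (x / α) := by positivity
  have hnX : ‖((C * Real.exp (x / α) : ℝ) : ℂ)‖ = C * Real.exp (x / α) := by
    rw [norm_real, Real.norm_of_nonneg hX.le]
  have h1 : varkappa β * max ‖(C : ℂ) * cexp ((x : ℂ) / α)‖ ‖z‖ ≤
      ‖C * cexp ((x : ℂ) / α) + z‖ := by
    rw [e, hnX]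
    exact varkappa_mul_max_le hβ hz hX.le
  have h2 : ∀ k, max ‖(C : ℂ) * cexp ((x : ℂ) / α)‖ (node ell k) ≤
      √2 * ‖C * cexp ((x : ℂ) / α) + node ell k‖ := by
    intro k
    rw [e, hnX]
    have := max_le_sqrt_two_mul_norm (φ := 0) hX (node_pos ell k)
      (by rw [Real.cos_zero]; linarith [Real.sqrt_nonneg 2])
    simpa using this
  have hz1 := norm_le_one_of_mem_sector hz
  have hW := prod_sqrt_two_mul_div_le hl' hz
  have hW' := prod_sqrt_two_mul_le hl' hz
  refine ⟨?_, ?_, ?_⟩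
  · have := norm_cIntegrand_le_exp (t := (x : ℂ)) (l := l) hC hκ
      (le_trans (mul_le_mul_of_nonneg_left (le_max_right _ _) hκ.le) h1)
      (fun k => (le_max_right _ _).trans (h2 k)) hW
    simpa using this
  · have := norm_cIntegrand_le_exp_neg (t := (x : ℂ)) (l := l) hC hα hl hl' hκ hz1
      (le_trans (mul_le_mul_of_nonneg_left (le_max_left _ _) hκ.le) h1)
      (fun k => (le_max_left _ _).trans (h2 k)) hW'
    simpa using this
  · have := norm_cIntegrand_le_envelope (t := (x : ℂ)) hC hα hl hl' hl01 hκ hz1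
      (Real.sqrt_nonneg 2) (by simp; positivity) h1 h2 hW hW'
    simpa using this

theorem continuous_lineIntegrand {C α β : ℝ} {ell l : ℕ} {z : ℂ} (hC : 0 < C)
    (hβ : β < 2) (hz : z ∈ sector β) : Continuous (lineIntegrand C α ell l z) := by
  rcases eq_or_ne z 0 with rfl | hz0
  · have : lineIntegrand C α ell l 0 = fun _ => 0 := by
      funext x
      simp [lineIntegrand]
    rw [this]
    exact continuous_const
  have hslit := mem_slitPlane_of_mem_sector hβ hz hz0
  unfold lineIntegrand
  refine Continuous.mul (Continuous.div (by fun_prop) (by fun_prop) fun x => ?_)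
    (continuous_finsetProd _ fun k _ => Continuous.div (by fun_prop) (by fun_prop) fun x => ?_)
  · intro h
    have hX : 0 < C * Real.exp (x / α) := by positivity
    have hzeq : z = ((-(C * Real.exp (x / α)) : ℝ) : ℂ) := by
      push_cast at h ⊢
      linear_combination h
    rw [hzeq, ofReal_mem_slitPlane] at hslit
    linarith
  · have hX : 0 < C * Real.exp (x / α) := by positivity
    have := node_pos ell k
    have h : C * Real.exp (x / α) + node ell k ≠ 0 := by positivity
    exact_mod_cast h

theorem integrable_lineIntegrand {C α β : ℝ} {ell l : ℕ} {z : ℂ} (hC : 0 < C)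
    (hα : 0 < α) (hl : α < ell + 1) (hl' : ell ≤ α + 1) (hl01 : l = 0 ∨ l = 1)
    (hβ : β < 2) (hz : z ∈ sector β) : Integrable (lineIntegrand C α ell l z) := by
  refine Integrable.mono' ((integrable_envelope (kappa_pos hα hl) (l := l)).const_mul
    (9 * growthBase β ^ α / varkappa β * scaleFactor C α))
    (continuous_lineIntegrand hC hβ hz).aestronglyMeasurable (ae_of_all _ fun x => ?_)
  rw [lineIntegrand_eq]
  exact (norm_cIntegrand_ofReal_le hC hα hl hl' hl01 hβ hz x).2.2

/-- All poles lie at height at least α(2 - β)π/2, since arg s ≥ -βπ/2. For β ≥ 1 the contour stays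
below the node poles, so a bound on the node residues is needed only for β < 1. -/
theorem sum_singSet_le {C α y β : ℝ} {ell l : ℕ} {z : ℂ} (hα : 0 < α)
    (hβ0 : 0 ≤ β) (hβ : β < 2) (hy : 0 ≤ y) (hz : z ∈ sector β) (hz0 : z ≠ 0)
    (hzn : ∀ k ∈ Finset.Icc 1 ell, z ≠ node ell k) {φ A B : ℝ} (hA : residueNorm C α ell l z z ≤ A)
    (hB0 : 0 ≤ B) (hB : β < 1 → ∑ k ∈ Finset.Icc 1 ell, residueNorm C α ell l z (node ell k) ≤ B)
    (hφ : 1 ≤ β → φ < Real.pi) :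
    ∑ s ∈ singSet ell z with α * (arg s + Real.pi) < α * φ,
        residueNorm C α ell l z s * Real.exp (-(y * (α * (arg s + Real.pi)))) ≤
      (A + B) * Real.exp (-(y * α * ((2 - β) * Real.pi / 2))) := by
  have hpi := Real.pi_pos
  have hr0 : ∀ s, 0 ≤ residueNorm C α ell l z s := fun s => by
    unfold residueNorm
    have : 0 ≤ ∏ w ∈ (singSet ell z).erase s, ‖w - s‖⁻¹ :=
      Finset.prod_nonneg fun _ _ => by positivity
    positivity
  have hmem : z ∉ (Finset.Icc 1 ell).image fun k => (node ell k : ℂ) := by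
    simp only [Finset.mem_image, not_exists, not_and]
    exact fun k hk h => hzn k hk h.symm
  have hargs : ∀ s ∈ singSet ell z, -(β * Real.pi / 2) ≤ arg s := by
    intro s hs
    simp only [singSet, Finset.mem_insert, Finset.mem_image] at hs
    rcases hs with rfl | ⟨k, -, rfl⟩
    · exact (abs_le.1 (abs_arg_le_of_mem_sector hβ hz hz0)).1
    · rw [arg_ofReal_of_nonneg (node_pos ell k).le]
      have : 0 ≤ β * Real.pi / 2 := by positivity
      linarith
  have hexp : ∀ s ∈ singSet ell z, Real.exp (-(y * (α * (arg s + Real.pi)))) ≤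
      Real.exp (-(y * α * ((2 - β) * Real.pi / 2))) := by
    intro s hs
    apply Real.exp_le_exp.2
    rw [neg_le_neg_iff, mul_assoc]
    have := hargs s hs
    gcongr
    linarith
  have hA0 : 0 ≤ A := (hr0 z).trans hA
  refine (Finset.sum_le_sum (g := fun s => residueNorm C α ell l z s *
    Real.exp (-(y * α * ((2 - β) * Real.pi / 2)))) fun s hs => mul_le_mul_of_nonneg_left
      (hexp s (Finset.mem_filter.1 hs).1) (hr0 s)).trans ?_
  rw [← Finset.sum_mul]
  refine mul_le_mul_of_nonneg_right ?_ (Real.exp_pos _).le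
  rcases lt_or_ge β 1 with h | h
  · refine (Finset.sum_le_sum_of_subset_of_nonneg (Finset.filter_subset _ _)
      fun s _ _ => hr0 s).trans ?_
    rw [singSet, Finset.sum_insert hmem, Finset.sum_image (nodeC_injOn ell)]
    exact add_le_add hA (hB h)
  · have hsub : (singSet ell z).filter (fun s => α * (arg s + Real.pi) < α * φ) ⊆ {z} := by
      intro s hs
      have hs1 := (Finset.mem_filter.1 hs).1
      have hs2 := lt_of_mul_lt_mul_left (Finset.mem_filter.1 hs).2 hα.le
      simp only [singSet, Finset.mem_insert, Finset.mem_image] at hs1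
      rcases hs1 with rfl | ⟨k, -, rfl⟩
      · simp
      · rw [arg_ofReal_of_nonneg (node_pos ell k).le] at hs2
        linarith [hφ h]
    refine (Finset.sum_le_sum_of_subset_of_nonneg hsub fun s _ _ => hr0 s).trans ?_
    rw [Finset.sum_singleton]
    linarith

theorem exists_norm_fourier_le {C : ℝ} (hC : 0 < C) : ∃ K : ℝ, 0 < K ∧
    ∀ β : ℝ, 0 ≤ β → β < 2 → ∀ α : ℝ, 0 < α → ∀ ell : ℕ, α < ell + 1 → ell ≤ α + 1 →
    ∀ l : ℕ, (l = 0 ∨ l = 1) → ∀ z ∈ sector β, ∀ y : ℝ, 0 ≤ y →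
      ‖∫ x : ℝ, lineIntegrand C α ell l z x * cexp (I * (y * x))‖ ≤
        K * (growthBase β ^ α * max 1 (C ^ α) * (1 + kappa α ell ^ (l + 1))) *
          Real.exp (-(y * α * ((2 - β) * Real.pi / 2))) := by
  obtain ⟨K₀, hK₀, hK⟩ := exists_one_add_sq_le
  obtain ⟨K₁, hK₁, hnode⟩ := exists_sum_residueNorm_node_le hC
  have hL := abs_nonneg (Real.log C)
  have hpi := Real.pi_pos
  have hm1 : 0 < max 1 (C ^ (-2 : ℝ)) := lt_max_of_lt_left one_pos
  refine ⟨9 / (1 / 8) * max 1 (C ^ (-2 : ℝ)) * 48 +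
    2 * Real.pi * ((|Real.log C| + 11) * K₀ + K₁), by positivity, ?_⟩
  intro β hβ0 hβ α hα ell hl hl' l hl01 z hz y hy
  have hκ := kappa_pos hα hl
  have hG := one_le_growthBase_rpow (β := β) hα
  have hG0 : 0 ≤ growthBase β ^ α := zero_le_one.trans hG
  have hmax : 1 ≤ max 1 (C ^ α) := le_max_left _ _
  -- In these cases the integrand vanishes identically; otherwise all poles are simple.
  by_cases hzero : z = 0 ∨ ∃ k ∈ Finset.Icc 1 ell, z = node ell k
  · have h0 : ∀ x, lineIntegrand C α ell l z x = 0 := by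
      intro x
      rcases hzero with rfl | ⟨k, hk, h⟩
      · simp [lineIntegrand]
      · rw [lineIntegrand, Finset.prod_eq_zero hk (by rw [h, sub_self, zero_div]), mul_zero]
    simp only [h0, zero_mul, integral_zero, norm_zero]
    positivity
  push Not at hzero
  obtain ⟨hz0, hzn⟩ := hzero
  have hz1 := norm_le_one_of_mem_sector hz
  obtain ⟨φ, hφ1, hφ5, hcos, hφpi, hdir⟩ := exists_contour_angle β hβ0 hz0
  have hφ0 : 0 ≤ φ := le_trans (by
    have : 0 ≤ 2 - β := by linarith
    positivity) hφ1
  have hint := integrable_lineIntegrand hC hα hl hl' hl01 hβ hz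
  have hfun : lineIntegrand C α ell l z = fun x : ℝ => cIntegrand C α ell l z x :=
    funext fun x => lineIntegrand_eq C α ell l z x
  have key := norm_fourier_le_of_contour (m := √2) (y := y) hC hα hl hl' hl01
    (by norm_num : (0 : ℝ) < 1 / 8) hz1 (mem_slitPlane_of_mem_sector hβ hz hz0) hzn (by positivity)
    hφ0 hφ5 hy hdir (fun X hX k => max_le_sqrt_two_mul_norm hX (node_pos ell k) hcos)
    (prod_sqrt_two_mul_div_le hl' hz) (prod_sqrt_two_mul_le hl' hz) (hfun ▸ hint)
  have hself := residueNorm_self_le (ell := ell) (l := l) hC hα hl01 hz0 hz1 hzn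
  have hself' : residueNorm C α ell l z z ≤ (|Real.log C| + 11) * K₀ * growthBase β ^ α := by
    refine hself.trans ?_
    rw [mul_assoc]
    gcongr
    exact (hK α hα).trans (mul_le_mul_of_nonneg_left (growthBase_rpow_ge hα) hK₀.le)
  have hsum := sum_singSet_le (φ := φ) hα hβ0 hβ hy hz hz0 hzn hself'
    (B := K₁ * growthBase β ^ α) (by positivity)
    (fun h => hnode β h α hα ell hl' l hl01 z hz hzn) hφpi
  simp only [lineIntegrand_eq]
  refine key.trans ?_
  set E := Real.exp (-(y * α * ((2 - β) * Real.pi / 2))) with hE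
  have hexp : Real.exp (-(y * (α * φ))) ≤ E := by
    apply Real.exp_le_exp.2
    rw [neg_le_neg_iff, mul_assoc]
    gcongr
  set V := growthBase β ^ α * max 1 (C ^ α) * (1 + kappa α ell ^ (l + 1)) with hV
  have hGV : growthBase β ^ α ≤ V := by
    rw [hV, mul_assoc]
    refine le_mul_of_one_le_right hG0 (one_le_mul_of_one_le_of_one_le hmax ?_)
    have : 0 ≤ kappa α ell ^ (l + 1) := by positivity
    linarith
  have hV0 : 0 ≤ V := hG0.trans hGV
  calc _ ≤ 9 * growthBase β ^ α / (1 / 8) * scaleFactor C α *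
        (48 * (1 + kappa α ell ^ (l + 1))) * E +
        2 * Real.pi * (((|Real.log C| + 11) * K₀ * growthBase β ^ α + K₁ * growthBase β ^ α) * E) := by
        have := scaleFactor_pos C α
        gcongr
    _ = 9 / (1 / 8) * max 1 (C ^ (-2 : ℝ)) * 48 * V * E +
        2 * Real.pi * ((|Real.log C| + 11) * K₀ + K₁) * growthBase β ^ α * E := by
        rw [hV, scaleFactor]
        ring
    _ ≤ 9 / (1 / 8) * max 1 (C ^ (-2 : ℝ)) * 48 * V * E +
        2 * Real.pi * ((|Real.log C| + 11) * K₀ + K₁) * V * E := by gcongr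
    _ = _ := by ring

end

/-! ### Tails of the lattice sum and the two error bounds. -/

section

open Filter Topology MeasureTheory Complex Set

theorem lineIntegrand_conj (C α : ℝ) (ell l : ℕ) (z : ℂ) (x : ℝ) :
    lineIntegrand C α ell l ((starRingEnd ℂ) z) x =
      (starRingEnd ℂ) (lineIntegrand C α ell l z x) := by
  simp only [lineIntegrand, map_mul, map_div₀, map_add, map_sub, map_prod, conj_ofReal]

theorem norm_integral_mul_cexp_neg (C α : ℝ) (ell l : ℕ) (z : ℂ) (y : ℝ) :
    ‖∫ x : ℝ, lineIntegrand C α ell l z x * cexp (-(I * (y * x)))‖ =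
      ‖∫ x : ℝ, lineIntegrand C α ell l ((starRingEnd ℂ) z) x * cexp (I * (y * x))‖ := by
  have h : ∀ x : ℝ, lineIntegrand C α ell l z x * cexp (-(I * (y * x))) =
      (starRingEnd ℂ) (lineIntegrand C α ell l ((starRingEnd ℂ) z) x * cexp (I * (y * x))) := by
    intro x
    rw [lineIntegrand_conj, map_mul, conj_conj, ← exp_conj]
    simp only [map_mul, conj_ofReal, conj_I, neg_mul]
  simp only [h]
  rw [integral_conj, RCLike.norm_conj]

theorem one_add_pow_mul_exp_neg_le {l : ℕ} (hl : l = 0 ∨ l = 1) {T v : ℝ} (hT : 0 ≤ T)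
    (hv : T ≤ v) : (1 + v) ^ l * Real.exp (-v) ≤ (1 + T) ^ l * Real.exp (-T) := by
  rcases hl with rfl | rfl
  · simpa using hv
  · rw [pow_one, pow_one]
    have h1 := Real.add_one_le_exp (v - T)
    have h2 : Real.exp (v - T) * Real.exp (-v) = Real.exp (-T) := by
      rw [← Real.exp_add]; congr 1; ring
    have h3 := Real.exp_pos (-v)
    have h4 : 1 + v ≤ (1 + T) * Real.exp (v - T) := by nlinarith
    calc (1 + v) * Real.exp (-v) ≤ (1 + T) * Real.exp (v - T) * Real.exp (-v) := by gcongr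
      _ = _ := by rw [mul_assoc, h2]

/-- Half of the decay past the point κv absorbs the linear factor, the other half sums as a
geometric series, and h r/(1 - r) ≤ 2κ makes the result independent of h. It serves the right tail
with κ and the left one with κ = 1. -/
theorem norm_tail_le {κ h A T v : ℝ} {l : ℕ} (hκ : 0 < κ) (hh : 0 < h) (hA : 0 ≤ A)
    (hl : l = 0 ∨ l = 1) (hT : 0 ≤ T) (hv : T ≤ v) {u : ℕ → ℂ}
    (hu : ∀ j : ℕ, ‖u j‖ ≤
      A * ((κ * v + (j + 1) * h) ^ l * Real.exp (-(κ * v + (j + 1) * h) / κ))) :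
    ‖(h : ℂ) * ∑' j, u j‖ ≤ A * (4 * κ ^ (l + 1)) * ((1 + T) ^ l * Real.exp (-T)) := by
  set r := Real.exp (-(h / (2 * κ))) with hr
  have hr0 : 0 < r := Real.exp_pos _
  have hr1 : r < 1 := Real.exp_lt_one_iff.2 (neg_lt_zero.2 (by positivity))
  have hv0 : 0 ≤ v := hT.trans hv
  have hterm : ∀ j : ℕ, ‖u j‖ ≤
      A * (κ ^ l * (2 * ((1 + v) ^ l * Real.exp (-v)))) * (r * r ^ j) := by
    intro j
    refine (hu j).trans ?_
    rw [mul_assoc]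
    refine mul_le_mul_of_nonneg_left ?_ hA
    set w := (j + 1) * h / κ with hw
    have hw0 : 0 ≤ w := by positivity
    have e1 : κ * v + (j + 1) * h = κ * (v + w) := by rw [hw]; field_simp
    have e2 : -(κ * (v + w)) / κ = -v + -w := by field_simp; ring
    have e3 : r * r ^ j = Real.exp (-(w / 2)) := by
      rw [← pow_succ', hr, ← Real.exp_nat_mul]
      congr 1
      rw [hw]
      push_cast
      field_simp
    rw [e1, e2, e3, mul_pow, Real.exp_add]
    have e4 : Real.exp (-w) = Real.exp (-(w / 2)) * Real.exp (-(w / 2)) := by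
      rw [← Real.exp_add]; congr 1; ring
    have hx0 := Real.exp_pos (-(w / 2))
    have hx1 : Real.exp (-(w / 2)) ≤ 1 := Real.exp_le_one_iff.2 (by linarith)
    have hwx : w * Real.exp (-(w / 2)) ≤ 2 := by
      have h1 := le_two_mul_exp_half w
      have h2 : Real.exp (w / 2) * Real.exp (-(w / 2)) = 1 := by
        rw [← Real.exp_add, add_neg_cancel, Real.exp_zero]
      nlinarith
    have hkey : (v + w) ^ l * Real.exp (-(w / 2)) ≤ 2 * (1 + v) ^ l := by
      rcases hl with rfl | rfl
      · simp only [pow_zero, one_mul]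
        linarith
      · rw [pow_one, pow_one]
        nlinarith
    have hκl : 0 ≤ κ ^ l := by positivity
    calc κ ^ l * (v + w) ^ l * (Real.exp (-v) * Real.exp (-w)) =
        κ ^ l * (((v + w) ^ l * Real.exp (-(w / 2))) * Real.exp (-v)) * Real.exp (-(w / 2)) := by
          rw [e4]; ring
      _ ≤ κ ^ l * ((2 * (1 + v) ^ l) * Real.exp (-v)) * Real.exp (-(w / 2)) := by gcongr
      _ = _ := by ring
  have hgeo : HasSum (fun j : ℕ => A * (κ ^ l * (2 * ((1 + v) ^ l * Real.exp (-v)))) * (r * r ^ j))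
      (A * (κ ^ l * (2 * ((1 + v) ^ l * Real.exp (-v)))) * (r * (1 - r)⁻¹)) :=
    ((hasSum_geometric_of_lt_one hr0.le hr1).mul_left r).mul_left _
  have hb := tsum_of_norm_bounded hgeo hterm
  have hrr : h * (r * (1 - r)⁻¹) ≤ 2 * κ := by
    have h1 := Real.add_one_le_exp (h / (2 * κ))
    have h2 : Real.exp (h / (2 * κ)) * r = 1 := by
      rw [hr, ← Real.exp_add, add_neg_cancel, Real.exp_zero]
    rw [← mul_assoc, ← div_eq_mul_inv, div_le_iff₀ (by linarith)]
    have h3 : (h / (2 * κ) + 1) * r ≤ 1 := (mul_le_mul_of_nonneg_right h1 hr0.le).trans_eq h2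
    have h4 : h / (2 * κ) * (2 * κ) = h := by field_simp
    nlinarith
  rw [norm_mul, norm_real, Real.norm_of_nonneg hh.le]
  have hle := one_add_pow_mul_exp_neg_le hl hT hv
  calc h * ‖∑' j, u j‖ ≤
      h * (A * (κ ^ l * (2 * ((1 + v) ^ l * Real.exp (-v)))) * (r * (1 - r)⁻¹)) := by gcongr
    _ = A * (κ ^ l * (2 * ((1 + v) ^ l * Real.exp (-v)))) * (h * (r * (1 - r)⁻¹)) := by ring
    _ ≤ A * (κ ^ l * (2 * ((1 + T) ^ l * Real.exp (-T)))) * (2 * κ) := by gcongr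
    _ = _ := by ring

theorem step_pos {α σ : ℝ} {N₁ : ℕ} (hα : 0 < α) (hσ : 0 < σ) (hN : 1 ≤ N₁) :
    0 < step α σ N₁ := by
  have : (0 : ℝ) < N₁ := by exact_mod_cast hN
  unfold step
  positivity

theorem trunc_eq {α σ : ℝ} {N₁ : ℕ} (hN : 1 ≤ N₁) : trunc α σ N₁ = N₁ * step α σ N₁ := by
  have h0 : (0 : ℝ) < N₁ := by exact_mod_cast hN
  have h1 : √(N₁ : ℝ) ≠ 0 := (Real.sqrt_pos.2 h0).ne'
  rw [trunc, step, mul_div_assoc', eq_div_iff h1]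
  rw [mul_assoc, Real.mul_self_sqrt h0.le]
  ring

/-- A bi-infinite sum as a finite window and two tails. -/
theorem tsum_int_eq_window {a : ℤ → ℂ} (ha : Summable a) (N₁ N : ℕ) :
    ∑' m : ℤ, a m = (∑ k ∈ Finset.range N, a ((k : ℤ) - N₁)) +
      (∑' j : ℕ, a (((j + N : ℕ) : ℤ) - N₁)) + ∑' j : ℕ, a (-((j : ℤ) + 1) - N₁) := by
  have hb : Summable fun m : ℤ => a (m - N₁) :=
    (Equiv.subRight (N₁ : ℤ)).summable_iff.2 ha
  have h1 : ∑' m : ℤ, a m = ∑' m : ℤ, a (m - N₁) :=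
    ((Equiv.subRight (N₁ : ℤ)).tsum_eq a).symm
  have hnat : Summable fun n : ℕ => a ((n : ℤ) - N₁) :=
    hb.comp_injective (i := ((↑) : ℕ → ℤ)) Nat.cast_injective
  have hneg : Summable fun n : ℕ => a (-((n : ℤ) + 1) - N₁) :=
    hb.comp_injective (i := fun n : ℕ => -((n : ℤ) + 1)) fun m n h => by
      simp only at h
      omega
  rw [h1, tsum_of_nat_of_neg_add_one (f := fun m : ℤ => a (m - N₁)) hnat hneg,
    ← hnat.sum_add_tsum_nat_add N]

/-- The trapezoidal error on the whole line and the contribution of the omitted nodes. -/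
theorem exists_norm_trapezoidal_errors_le (C : ℝ) (hC : 0 < C) :
    ∃ K : ℝ, 0 < K ∧
      ∀ (β : ℝ), 0 ≤ β → β < 2 →
      ∀ (α : ℝ), 0 < α → ∀ (σ : ℝ), 0 < σ → ∀ (N₁ : ℕ), 1 ≤ N₁ →
      ∀ (l : ℕ), (l = 0 ∨ l = 1) →
      ∀ (ell : ℕ), α < ell + 1 → ell ≤ α + 1 →
      ∀ z ∈ LightningQuadrature.sector β,
          ‖(∫ t, lineIntegrand C α ell l z t) -
            step α σ N₁ * ∑' n : ℤ, lineIntegrand C α ell l z (n * step α σ N₁)‖ ≤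
            K * (growthBase β ^ α * max 1 (C ^ α) /
                (varkappa β * (Real.exp ((2 - β) * α * Real.pi ^ 2 / step α σ N₁) - 1)) *
                (1 + kappa α ell ^ (l + 1))) ∧
          ‖step α σ N₁ * ∑' n : ℤ, lineIntegrand C α ell l z (n * step α σ N₁) -
            rectangularRule C α σ ell N₁ l z‖ ≤
            K * (growthBase β ^ α * max 1 (C ^ α) * (1 + trunc α σ N₁) ^ l *
                (1 + kappa α ell ^ (l + 1)) * (Real.exp (-trunc α σ N₁) / varkappa β)) := by
  obtain ⟨K₀, hK₀, hF⟩ := exists_norm_fourier_le hC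
  have hm1 : 0 < max 1 (C ^ (-2 : ℝ)) := lt_max_of_lt_left one_pos
  -- The 2 counts positive and negative frequencies; 36 = 9 · 4 combines the constants of the
  -- pointwise bound and of `norm_tail_le`.
  refine ⟨2 * K₀ + 36 * max 1 (C ^ (-2 : ℝ)), by positivity, ?_⟩
  intro β hβ0 hβ α hα σ hσ N₁ hN l hl01 ell hl hl' z hz
  have hκ := kappa_pos hα hl
  have hϰ := varkappa_pos hβ
  have hϰ1 := varkappa_le_one (β := β)
  have hh := step_pos hα hσ hN
  have hpi := Real.pi_pos
  have hT := trunc_eq (α := α) (σ := σ) hN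
  have hNpos : (0 : ℝ) < N₁ := by exact_mod_cast hN
  have hT0 : 0 ≤ trunc α σ N₁ := by rw [hT]; positivity
  set h := step α σ N₁ with hhdef
  set T := trunc α σ N₁ with hTdef
  set κ := kappa α ell with hκdef
  have hG := one_le_growthBase_rpow (β := β) hα
  have hG0 : 0 < growthBase β ^ α := one_pos.trans_le hG
  have hmax : 0 < max 1 (C ^ α) := lt_max_of_lt_left one_pos
  obtain ⟨M, hM⟩ := exists_envelope_le (l := l) hκ
  have hbound := norm_cIntegrand_ofReal_le (l := l) hC hα hl hl' hl01 hβ hz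
  have hA : 0 ≤ 9 * growthBase β ^ α / varkappa β * scaleFactor C α := by
    have := scaleFactor_pos C α
    positivity
  have hdecay : ∀ t, ‖lineIntegrand C α ell l z t‖ ≤
      9 * growthBase β ^ α / varkappa β * scaleFactor C α * M * (1 + t ^ 2)⁻¹ := by
    intro t
    rw [lineIntegrand_eq, mul_assoc _ M]
    exact (hbound t).2.2.trans (mul_le_mul_of_nonneg_left (hM t) hA)
  have hsum := summable_comp_mul_of_le_inv_one_add_sq hh hdecay
  constructor
  · set x := (2 - β) * α * Real.pi ^ 2 / h with hx
    have hx0 : 0 < x := by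
      have : 0 < 2 - β := by linarith
      positivity
    have hq1 : Real.exp (-x) < 1 := Real.exp_lt_one_iff.2 (by linarith)
    have hexp : ∀ n : ℕ, Real.exp (-(2 * Real.pi * (n + 1) / h * α * ((2 - β) * Real.pi / 2))) =
        Real.exp (-x) ^ (n + 1) := by
      intro n
      rw [← Real.exp_nat_mul]
      congr 1
      rw [hx]
      push_cast
      field_simp
    have hD := norm_integral_sub_tsum_le (continuous_lineIntegrand hC hβ hz) hh hdecay
      (B := K₀ * (growthBase β ^ α * max 1 (C ^ α) * (1 + κ ^ (l + 1))))
      (Real.exp_pos (-x)).le hq1 (fun n => ?_) (fun n => ?_)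
    · refine hD.trans ?_
      have e : Real.exp (-x) / (1 - Real.exp (-x)) = 1 / (Real.exp x - 1) := by
        have h1 : Real.exp x - 1 ≠ 0 := by
          have := Real.add_one_lt_exp hx0.ne'
          linarith
        have h2 : 1 - Real.exp (-x) ≠ 0 := by linarith
        rw [div_eq_div_iff h2 h1, mul_sub, ← Real.exp_add, neg_add_cancel, Real.exp_zero]
        ring
      have hE : 0 < Real.exp x - 1 := by
        have := Real.add_one_lt_exp hx0.ne'
        linarith
      rw [e]
      have e2 : growthBase β ^ α * max 1 (C ^ α) / (varkappa β * (Real.exp x - 1)) *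
          (1 + κ ^ (l + 1)) = growthBase β ^ α * max 1 (C ^ α) * (1 + κ ^ (l + 1)) *
          (1 / (Real.exp x - 1)) * (1 / varkappa β) := by field_simp
      rw [e2]
      -- The Fourier bound is free of ϰ; its inverse is inserted only to match the stated form.
      have h1 : 1 ≤ 1 / varkappa β := by rw [le_div_iff₀ hϰ]; linarith
      set V := growthBase β ^ α * max 1 (C ^ α) * (1 + κ ^ (l + 1)) * (1 / (Real.exp x - 1)) with hV
      have hV0 : 0 ≤ V := by positivity
      calc 2 * (K₀ * (growthBase β ^ α * max 1 (C ^ α) * (1 + κ ^ (l + 1)))) *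
          (1 / (Real.exp x - 1)) = 2 * K₀ * (V * 1) := by rw [hV]; ring
        _ ≤ 2 * K₀ * (V * (1 / varkappa β)) := by gcongr
        _ ≤ _ := mul_le_mul_of_nonneg_right (by linarith) (by positivity)
    · rw [← hexp]
      exact hF β hβ0 hβ α hα ell hl hl' l hl01 z hz _ (by positivity)
    · rw [← hexp, norm_integral_mul_cexp_neg]
      exact hF β hβ0 hβ α hα ell hl hl' l hl01 _ (conj_mem_sector hz) _ (by positivity)
  · set N := numNodes α ell N₁ with hNdef
    have hrect : rectangularRule C α σ ell N₁ l z =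
        h * ∑ k ∈ Finset.range (N + 1), lineIntegrand C α ell l z (((k : ℤ) - N₁ : ℤ) * h) := by
      rw [rectangularRule]
      congr 1
      refine Finset.sum_congr rfl fun k _ => ?_
      rw [shiftedIntegrand, ← hTdef, hT]
      congr 1
      push_cast
      ring
    rw [tsum_int_eq_window (a := fun n : ℤ => lineIntegrand C α ell l z (n * h)) hsum N₁ (N + 1),
      hrect]
    have hNge : (κ + 1) * N₁ ≤ N := Nat.le_ceil _
    set A := 9 * growthBase β ^ α / varkappa β * scaleFactor C α with hAdef
    -- N ≥ (κ + 1)N₁ gives v ≥ T. The last node used is (N - N₁)h, so the tail starts one step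
    -- later, which is the j + 1.
    have hright := norm_tail_le (l := l) (v := (N - N₁) * h / κ) hκ hh hA hl01 hT0 (by
      rw [hT, le_div_iff₀ hκ]
      have : (N₁ : ℝ) * κ ≤ N - N₁ := by linarith
      nlinarith) (u := fun j : ℕ => lineIntegrand C α ell l z
        ((((j + (N + 1) : ℕ) : ℤ) - N₁ : ℤ) * h)) (fun j => by
      have e : ((((j + (N + 1) : ℕ) : ℤ) - N₁ : ℤ) : ℝ) * h =
          κ * ((N - N₁) * h / κ) + (j + 1) * h := by
        push_cast
        field_simp
        ring
      have hpos : 0 ≤ κ * ((N - N₁) * h / κ) + (j + 1) * h := by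
        have h1 : (0 : ℝ) ≤ N - N₁ := by nlinarith
        positivity
      rw [e, lineIntegrand_eq]
      have := (hbound (κ * ((N - N₁) * h / κ) + (j + 1) * h)).2.1
      rwa [abs_of_nonneg hpos] at this)
    have hleft := norm_tail_le (l := l) (v := T) one_pos hh hA hl01 hT0 le_rfl
      (u := fun j : ℕ => lineIntegrand C α ell l z ((-((j : ℤ) + 1) - N₁ : ℤ) * h)) (fun j => by
      have e : ((-((j : ℤ) + 1) - N₁ : ℤ) : ℝ) * h = -(1 * T + (j + 1) * h) := by
        rw [hT]
        push_cast
        ring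
      have hpos : 0 ≤ 1 * T + (j + 1) * h := by positivity
      rw [e, lineIntegrand_eq]
      have := (hbound (-(1 * T + (j + 1) * h))).1
      rw [abs_neg, abs_of_nonneg hpos] at this
      rwa [div_one])
    set Sw := ∑ k ∈ Finset.range (N + 1), lineIntegrand C α ell l z (((k : ℤ) - N₁ : ℤ) * h)
    set Sr := ∑' j : ℕ, lineIntegrand C α ell l z ((((j + (N + 1) : ℕ) : ℤ) - N₁ : ℤ) * h)
    set Sl := ∑' j : ℕ, lineIntegrand C α ell l z ((-((j : ℤ) + 1) - N₁ : ℤ) * h)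
    have e : (h : ℂ) * (Sw + Sr + Sl) - h * Sw = h * Sr + h * Sl := by ring
    rw [e]
    refine ((norm_add_le _ _).trans (add_le_add hright hleft)).trans ?_
    have hp : 0 ≤ growthBase β ^ α * max 1 (C ^ α) * (1 + T) ^ l *
                (1 + κ ^ (l + 1)) * (Real.exp (-T) / varkappa β) := by positivity
    calc _ = 36 * max 1 (C ^ (-2 : ℝ)) * (growthBase β ^ α * max 1 (C ^ α) * (1 + T) ^ l *
          (1 + κ ^ (l + 1)) * (Real.exp (-T) / varkappa β)) := by
          rw [hAdef, scaleFactor]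
          ring
      _ ≤ _ := mul_le_mul_of_nonneg_right (by linarith) hp

end

end LightningQuadrature

/-! ### Assembly of the error identity. -/

theorem corollary5p3 (C : ℝ) (hC : 0 < C) :
    ∃ K : ℝ, 0 < K ∧
      ∀ (β : ℝ), 0 ≤ β → β < 2 →
      ∀ (α : ℝ), 0 < α → ∀ (σ : ℝ), 0 < σ → ∀ (N₁ : ℕ), 1 ≤ N₁ →
      ∀ (l : ℕ), (l = 0 ∨ l = 1) →
      ∀ (ell : ℕ), (ell = ⌊α⌋₊ ∨ ell = ⌈α⌉₊) →
      ∀ z ∈ LightningQuadrature.sector β,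
        MeasureTheory.Integrable (LightningQuadrature.lineIntegrand C α ell l z) ∧
        ∃ c₁ c₂ : ℂ, ‖c₁‖ ≤ K ∧ ‖c₂‖ ≤ K ∧
          LightningQuadrature.quadError C α σ ell N₁ l z =
            ((LightningQuadrature.growthBase β ^ α * max 1 (C ^ α) /
                (LightningQuadrature.varkappa β *
                  (Real.exp ((2 - β) * α * Real.pi ^ 2 / LightningQuadrature.step α σ N₁) - 1)) *
                (1 + LightningQuadrature.kappa α ell ^ (l + 1)) : ℝ) : ℂ) * c₁
            - LightningQuadrature.truncError C α σ ell N₁ l z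
            + ((LightningQuadrature.growthBase β ^ α * max 1 (C ^ α) *
                (1 + LightningQuadrature.trunc α σ N₁) ^ l *
                (1 + LightningQuadrature.kappa α ell ^ (l + 1)) *
                (Real.exp (-LightningQuadrature.trunc α σ N₁) /
                  LightningQuadrature.varkappa β) : ℝ) : ℂ) * c₂ := by
  open LightningQuadrature in
  obtain ⟨K, hK, hmain⟩ := exists_norm_trapezoidal_errors_le C hC
  refine ⟨K, hK, ?_⟩
  intro β hβ0 hβ α hα σ hσ N₁ hN l hl01 ell hell z hz
  have hl : α < ell + 1 := by
    rcases hell with rfl | rfl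
    · exact Nat.lt_floor_add_one α
    · linarith [Nat.le_ceil α]
  have hl' : (ell : ℝ) ≤ α + 1 := by
    rcases hell with rfl | rfl
    · linarith [Nat.floor_le hα.le]
    · exact (Nat.ceil_lt_add_one hα.le).le
  obtain ⟨h1, h2⟩ := hmain β hβ0 hβ α hα σ hσ N₁ hN l hl01 ell hl hl' z hz
  refine ⟨integrable_lineIntegrand hC hα hl hl' hl01 hβ hz, ?_⟩
  have hκ := kappa_pos hα hl
  have hϰ := varkappa_pos hβ
  have hh := step_pos hα hσ hN
  have hT0 : 0 ≤ trunc α σ N₁ := by rw [trunc_eq hN]; positivity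
  have hG0 : 0 < growthBase β ^ α := one_pos.trans_le (one_le_growthBase_rpow hα)
  have hmax : 0 < max 1 (C ^ α) := lt_max_of_lt_left one_pos
  have hE : 0 < Real.exp ((2 - β) * α * Real.pi ^ 2 / step α σ N₁) - 1 := by
    have h2β : 0 < 2 - β := by linarith
    have hpi := Real.pi_pos
    have : 0 < (2 - β) * α * Real.pi ^ 2 / step α σ N₁ := by positivity
    linarith [Real.add_one_lt_exp this.ne']
  set X := growthBase β ^ α * max 1 (C ^ α) /
    (varkappa β * (Real.exp ((2 - β) * α * Real.pi ^ 2 / step α σ N₁) - 1)) *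
      (1 + kappa α ell ^ (l + 1)) with hX
  set Y := growthBase β ^ α * max 1 (C ^ α) * (1 + trunc α σ N₁) ^ l *
    (1 + kappa α ell ^ (l + 1)) * (Real.exp (-trunc α σ N₁) / varkappa β) with hY
  have hX0 : 0 < X := by positivity
  have hY0 : 0 < Y := by positivity
  set D := (∫ t, lineIntegrand C α ell l z t) -
    step α σ N₁ * ∑' n : ℤ, lineIntegrand C α ell l z (n * step α σ N₁) with hD
  set R := step α σ N₁ * ∑' n : ℤ, lineIntegrand C α ell l z (n * step α σ N₁) -
    rectangularRule C α σ ell N₁ l z with hR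
  -- X and Y are strictly positive, so the identity reduces to E_Q = D - E_T + R, in which the
  -- truncated integral and the lattice sum cancel.
  refine ⟨D / X, R / Y, ?_, ?_, ?_⟩
  · rw [norm_div, Complex.norm_real, Real.norm_of_nonneg hX0.le, div_le_iff₀ hX0]
    exact h1
  · rw [norm_div, Complex.norm_real, Real.norm_of_nonneg hY0.le, div_le_iff₀ hY0]
    exact h2
  · have hXc : (X : ℂ) ≠ 0 := by exact_mod_cast hX0.ne'
    have hYc : (Y : ℂ) ≠ 0 := by exact_mod_cast hY0.ne'
    rw [mul_div_cancel₀ _ hXc, mul_div_cancel₀ _ hYc, quadError, truncError, hD, hR]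
    ring
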